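/- **Diagrams.** An $n$-punctured ball tangle diagram $T^n$ ($n\ge 0$) is a diagram (with finitely many transverse double points carrying over/under information) of a compact 1-manifold, possibly with closed components, properly embedded in a 3-ball from which $n$ disjoint open balls (holes numbered $1,\dots,n$) are removed, the boundary of the 1-manifold consisting of exactly four points NE, NW, SW, SE on each of the $n+1$ boundary spheres. Combinatorially it is a plane graph with a 4-valent vertex for each crossing and each boundary circle (and bend points on the edges), with the cyclic order of the four edge ends at each of these, the under/over pairs at the crossings, and the labels of the four points at the boundary circles; the relative position of different connected components of this graph plays no role and is not recorded. For an $n$-punctured diagram $T^n$ and $k_j$-punctured diagrams $T^{k_j(j)}$ ($1\le j\le n$), the composite $T^n(T^{k_1(1)},\dots,T^{k_n(n)})$ is obtained by filling the $j$-th hole of $T^n$ with $T^{k_j(j)}$, the points NE, NW, SW, SE being matched; its holes are those of $T^{k_1(1)}$ in order, then those of $T^{k_2(2)}$, and so on. **Bracket.** Let $A=e^{i\pi/4}$. The Kauffman bracket of a link diagram $L$ is $\langle L\rangle=\sum_\sigma A^{\alpha(\sigma)}A^{-\beta(\sigma)}(-A^2-A^{-2})^{d(\sigma)-1}$, the sum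 being over all states $\sigma$ (a choice of the $A$- or $B$-splitting at each crossing), where $\alpha(\sigma)$ and $\beta(\sigma)$ are the numbers of $A$- and $B$-splittings and $d(\sigma)$ is the number of circles of the resolution; here $0^0=1$. **Invariant.** Order $\{1,2\}^n$ by the dictionary order, $\alpha^n_1<\dots<\alpha^n_{2^n}$, write $\alpha^n_i=(\alpha^n_{i1},\dots,\alpha^n_{in})$, and let $t_i$ be the number of entries of $\alpha^n_i$ equal to $2$. For $r\in\{1,2\}$ let $T^n_{r\alpha^n_i}$ be the link diagram obtained by filling the $j$-th hole with the fundamental tangle $\alpha^n_{ij}$ (tangle 1: arcs NW–SW and NE–SE; tangle 2: arcs NW–NE and SW–SE) and then taking the numerator closure if $r=1$ (joining NW with NE and SW with SE outside) or the denominator closure if $r=2$ (joining NW with SW and NE with SE outside). For an integer matrix $M$ put $[M]=\{M,-M\}$, and let $PM_{2\times 2^n}(\mathbb Z)$ be the set of all $[M]$ with $M$ an integer $2\times2^n$ matrix. Put $$F^n(T^n)=\left\{\begin{pmatrix}(-i)^{t_1}z\langle T^n_{1\alpha^n_1}\rangle&\cdots&(-i)^{t_{2^n}}z\langle T^n_{1\alpha^n_{2^n}}\rangle\\(-i)^{t_1}iz\langle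 T^n_{2\alpha^n_1}\rangle&\cdots&(-i)^{t_{2^n}}iz\langle T^n_{2\alpha^n_{2^n}}\rangle\end{pmatrix}\;\middle|\;z\in\mathbb C,\ z^8=1\right\}\cap M_{2\times2^n}(\mathbb Z).$$ **Theorem 3.2.** Let $n\ge1$ and $k_1,\dots,k_n\ge0$ be integers, and let $T^n,T^{k_1(1)},\dots,T^{k_n(n)}$ be $n,k_1,\dots,k_n$-punctured ball tangle diagrams. Then $T^n(T^{k_1(1)},\dots,T^{k_n(n)})$ is a $(k_1+\cdots+k_n)$-punctured ball tangle diagram, $F^n(T^n)\in PM_{2\times2^n}(\mathbb Z)$, $F^{k_j}(T^{k_j(j)})\in PM_{2\times2^{k_j}}(\mathbb Z)$ for all $j$, and whenever $F^n(T^n)=[M]$ and $F^{k_j}(T^{k_j(j)})=[(b^j_{rs})]$ for $1\le j\le n$, $$F^{k_1+\cdots+k_n}\bigl(T^n(T^{k_1(1)},\dots,T^{k_n(n)})\bigr)=[M\,\eta],$$ where $\eta$ is the $2^n\times2^{k_1+\cdots+k_n}$ matrix with entries $$\eta_{il}=\prod_{j=1}^n b^j_{\alpha^n_{ij}\,\beta_{lj}},$$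 and $\beta_1<\beta_2<\cdots<\beta_{2^{k_1+\cdots+k_n}}$ are the elements $\beta_l=(\beta_{l1},\dots,\beta_{ln})$ of $\prod_{j=1}^n\{1,\dots,2^{k_j}\}$ in the dictionary order. In other words, $F^{k_1+\cdots+k_n}(T^n(T^{k_1(1)},\dots,T^{k_n(n)}))=F^n(T^n)\,[\eta^n](F^{k_1}(T^{k_1(1)}),\dots,F^{k_n}(T^{k_n(n)}))$ with $[\eta^n](\dots)=[\eta]$. -/

import Mathlib

/-!
Diagrams of links and of punctured ball tangles are polygonal and are encoded combinatorially, as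
four-valent plane graphs with crossing information: a diagram is cut at its crossings and at
finitely many bend points into edges, and the data record which edge ends belong to the same edge,
which ends meet at a bend point, and, at every crossing and at every boundary circle, the cyclic
order of the four ends there. Planarity is the Euler characteristic condition. A closed component
without crossings is a polygon whose only vertices are bend points.
-/

noncomputable section

namespace PuncturedTangle

/-- The perfect matching `0 - 1`, `2 - 3` of four cyclically ordered points. -/
def pair01 : Equiv.Perm (Fin 4) := Equiv.swap 0 1 * Equiv.swap 2 3

/-- The perfect matching `1 - 2`, `3 - 0` of four cyclically ordered points. -/
def pair12 : Equiv.Perm (Fin 4) := Equiv.swap 1 2 * Equiv.swap 3 0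

theorem pair01_invol : ∀ i, pair01 (pair01 i) = i := by decide
theorem pair12_invol : ∀ i, pair12 (pair12 i) = i := by decide
theorem pair01_ne : ∀ i, pair01 i ≠ i := by decide
theorem pair12_ne : ∀ i, pair12 i ≠ i := by decide

/-! ### Link diagrams and the Kauffman bracket -/

/-- The code of a link diagram. `Bend` is the set of edge ends at bend points, and `bend` exchanges
the two ends that meet at a bend point. The four ends at a crossing `c` are `(c, 0)`, `(c, 1)`,
`(c, 2)`, `(c, 3)` in counterclockwise order, where `(c, 0)`, `(c, 2)` belong to the under-strand
and `(c, 1)`, `(c, 3)` to the over-strand. `edge` exchanges the two ends of each edge. -/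
structure LinkCode where
  Bend : Type
  Crossing : Type
  [fintypeBend : Fintype Bend]
  [fintypeCrossing : Fintype Crossing]
  [decEqCrossing : DecidableEq Crossing]
  bend : Equiv.Perm Bend
  bend_invol : ∀ x, bend (bend x) = x
  bend_ne : ∀ x, bend x ≠ x
  edge : Equiv.Perm (Bend ⊕ Crossing × Fin 4)
  edge_invol : ∀ x, edge (edge x) = x
  edge_ne : ∀ x, edge x ≠ x

attribute [instance] LinkCode.fintypeBend LinkCode.fintypeCrossing LinkCode.decEqCrossing

namespace LinkCode

variable (L : LinkCode)

/-- The edge ends of a link diagram. -/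
abbrev Dart : Type := L.Bend ⊕ L.Crossing × Fin 4

/-- A state chooses the `A`-type splitting (`true`) or the `B`-type splitting (`false`) at every
crossing. -/
abbrev State : Type := L.Crossing → Bool

/-- How edge ends are joined at the vertices of the resolution `L_σ`. The `A`-type splitting joins
the two regions swept out when the over-strand is turned counterclockwise, that is, the regions
between `1` and `2` and between `3` and `0`; so its arcs are `0 - 1` and `2 - 3`. The `B`-type
splitting has the arcs `1 - 2` and `3 - 0`. -/
def join (σ : L.State) : Equiv.Perm L.Dart :=
  Equiv.sumCongr L.bend
    (Equiv.prodCongrRight fun c => if σ c = true then pair01 else pair12)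

/-- The number `d(σ)` of circles in the resolution `L_σ`. -/
def circles (σ : L.State) : ℕ :=
  Nat.card (Quot fun x y : L.Dart => L.edge x = y ∨ L.join σ x = y)

/-- The Kauffman bracket as a state sum. -/
def bracket (a : ℂ) : ℂ :=
  ∑ σ : L.State,
    a ^ (Finset.univ.filter fun c => σ c = true).card *
      a⁻¹ ^ (Finset.univ.filter fun c => σ c = false).card *
      (-a ^ 2 - a⁻¹ ^ 2) ^ ((L.circles σ : ℤ) - 1)

end LinkCode

/-- The number `e^{iπ/4}`. -/
def root8 : ℂ := Complex.exp (Real.pi / 4 * Complex.I)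

/-! ### Punctured ball tangle diagrams -/

/-- The code of an `n`-punctured ball tangle diagram. Bend points, crossings and edges are as for
link diagrams. The boundary circles are indexed by `Option (Fin n)`: `none` is the outer circle and
`some j` is the circle around the `j`-th hole. Each boundary circle `o` carries four edge ends
`(o, 0)`, `(o, 1)`, `(o, 2)`, `(o, 3)`, at its points NE, NW, SW, SE, which is the counterclockwise
order along the boundary of the disk bounded by the circle. -/
structure TangleCode (n : ℕ) where
  Bend : Type
  Crossing : Type
  [fintypeBend : Fintype Bend]
  [fintypeCrossing : Fintype Crossing]
  [decEqCrossing : DecidableEq Crossing]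
  bend : Equiv.Perm Bend
  bend_invol : ∀ x, bend (bend x) = x
  bend_ne : ∀ x, bend x ≠ x
  edge : Equiv.Perm ((Bend ⊕ Option (Fin n) × Fin 4) ⊕ Crossing × Fin 4)
  edge_invol : ∀ x, edge (edge x) = x
  edge_ne : ∀ x, edge x ≠ x

attribute [instance] TangleCode.fintypeBend TangleCode.fintypeCrossing TangleCode.decEqCrossing

/-- The number of cycles of a permutation, fixed points included. -/
def numCycles {X : Type} (π : Equiv.Perm X) : ℕ := Nat.card (Quot fun x y : X => π x = y)

namespace TangleCode

variable {n : ℕ} (T : TangleCode n)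

/-- The edge ends of a tangle diagram. -/
abbrev Dart : Type := (T.Bend ⊕ Option (Fin n) × Fin 4) ⊕ T.Crossing × Fin 4

/-- The counterclockwise rotation of the edge ends around each vertex of the graph on the sphere
that is obtained by collapsing to a point each hole and the outside of the outer circle. Seen from
the outside, the four points on the outer circle come in the opposite order. -/
def rot : Equiv.Perm T.Dart :=
  Equiv.sumCongr
    (Equiv.sumCongr T.bend
      (Equiv.prodCongrRight fun o : Option (Fin n) =>
        o.elim (Equiv.subRight (1 : Fin 4)) fun _ => Equiv.addRight (1 : Fin 4)))
    (Equiv.prodCongrRight fun _ => Equiv.addRight (1 : Fin 4))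

/-- The number of connected components of that graph. -/
def numComponents : ℕ :=
  Nat.card (Quot fun x y : T.Dart => T.edge x = y ∨ T.rot x = y)

/-- That graph is plane: `V - E + F = 2 C`, where the vertices, edges and faces are the cycles of
`rot`, of `edge` and of `rot * edge`, and `C` is the number of components. (Every component has
`V - E + F ≤ 2`, so this says that every component lies on a sphere.) -/
def IsPlanar : Prop :=
  numCycles T.rot + numCycles (T.rot * T.edge) = numCycles T.edge + 2 * T.numComponents

end TangleCode

/-- An `n`-punctured ball tangle diagram. -/
structure TangleDiagram (n : ℕ) extends TangleCode n where
  planar : toTangleCode.IsPlanar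

/-! ### Closures and the invariant -/

namespace TangleCode

variable {n : ℕ} (T : TangleCode n)

/-- The arcs put at a boundary circle to form a closure. The value `0 : Fin 2` stands for the
symbol `1` and `1 : Fin 2` for the symbol `2`. Outside the outer circle, the numerator closure
(`r = 0`) joins NE with NW and SW with SE, and the denominator closure (`r = 1`) joins NW with SW
and SE with NE. A hole is filled by the fundamental tangle `1` (`α j = 0`), with the arcs NW - SW
and SE - NE, or by the fundamental tangle `2` (`α j = 1`), with the arcs NE - NW and SW - SE. -/
def cap (r : Fin 2) (α : Fin n → Fin 2) (o : Option (Fin n)) : Equiv.Perm (Fin 4) :=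
  o.elim (if r = 0 then pair01 else pair12) fun j => if α j = 0 then pair12 else pair01

/-- The link diagram `T_{rα}`: the holes of `T` are filled by the fundamental tangles `α`, and
then the numerator (`r = 0`) or denominator (`r = 1`) closure is taken. -/
def closure (r : Fin 2) (α : Fin n → Fin 2) : LinkCode where
  Bend := T.Bend ⊕ Option (Fin n) × Fin 4
  Crossing := T.Crossing
  bend := Equiv.sumCongr T.bend (Equiv.prodCongrRight (cap r α))
  bend_invol := by
    rintro (x | ⟨_ | j, i⟩)
    · simp [T.bend_invol]
    · simp only [cap, Equiv.sumCongr_apply, Sum.map_inr, Equiv.prodCongrRight_apply,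
        Option.elim_none]
      split_ifs <;> simp [pair01_invol, pair12_invol]
    · simp only [cap, Equiv.sumCongr_apply, Sum.map_inr, Equiv.prodCongrRight_apply,
        Option.elim_some]
      split_ifs <;> simp [pair01_invol, pair12_invol]
  bend_ne := by
    rintro (x | ⟨_ | j, i⟩)
    · simp [T.bend_ne]
    · simp only [cap, Equiv.sumCongr_apply, Sum.map_inr, Equiv.prodCongrRight_apply,
        Option.elim_none]
      split_ifs <;> simp [pair01_ne, pair12_ne]
    · simp only [cap, Equiv.sumCongr_apply, Sum.map_inr, Equiv.prodCongrRight_apply,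
        Option.elim_some]
      split_ifs <;> simp [pair01_ne, pair12_ne]
  edge := T.edge
  edge_invol := T.edge_invol
  edge_ne := T.edge_ne

end TangleCode

/-- The enumeration `α_1 < α_2 < ⋯ < α_m` of `∏ i, {1, …, k i}` in the dictionary order. -/
def dict {n : ℕ} (k : Fin n → ℕ) (m : ℕ) (h : ∏ i, k i = m) :
    Fin m ≃o Lex (∀ i, Fin (k i)) :=
  Fintype.orderIsoFinOfCardEq (Lex (∀ i, Fin (k i))) (by
    rw [← h]
    exact (Fintype.card_congr (ofLex : Lex (∀ i, Fin (k i)) ≃ _)).trans (by simp))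

/-- `dictTwo n i` is the `i`-th element of `{1, 2}^n` in the dictionary order. -/
def dictTwo (n : ℕ) (i : Fin (2 ^ n)) : Fin n → Fin 2 :=
  ofLex (dict (fun _ : Fin n => 2) (2 ^ n) (by simp) i)

/-- `dictPow k i` is the `i`-th element of `∏ j, {1, …, 2 ^ k j}` in the dictionary order. -/
def dictPow {n : ℕ} (k : Fin n → ℕ) (i : Fin (2 ^ ∑ j, k j)) : ∀ j, Fin (2 ^ k j) :=
  ofLex (dict (fun j => 2 ^ k j) (2 ^ ∑ j, k j) (Finset.prod_pow_eq_pow_sum _ _ _) i)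

/-- The number of entries of `α` that are equal to the symbol `2`. For `α = α_i` this is the
`i`-th term of the sequence `0, 1, 1, 2, …` obtained from `(0)` by repeatedly appending to a
sequence the same sequence with all terms increased by `1`. -/
def countTwo {n : ℕ} (α : Fin n → Fin 2) : ℕ := (Finset.univ.filter fun j => α j = 1).card

/-- The invariant `F^n(T)`, as the set of all integer matrices among the matrices with entries
`(-i)^t z ⟨T_{1α}⟩` (first row) and `(-i)^t i z ⟨T_{2α}⟩` (second row), where `z ^ 8 = 1`. -/
def TangleCode.invariant {n : ℕ} (T : TangleCode n) : Set (Matrix (Fin 2) (Fin (2 ^ n)) ℤ) :=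
  {M | ∃ z : ℂ, z ^ 8 = 1 ∧ ∀ r i,
    (M r i : ℂ) = (-Complex.I) ^ countTwo (dictTwo n i) * Complex.I ^ (r : ℕ) * z *
      (T.closure r (dictTwo n i)).bracket root8}

/-- The class `[M]` of an integer matrix modulo multiplication by `±1`. -/
def projClass {p q : Type} (M : Matrix p q ℤ) : Set (Matrix p q ℤ) := {M, -M}

/-! ### Filling the holes by punctured ball tangles -/

section fill

variable {n : ℕ} {k : Fin n → ℕ}

/-- Edge ends at the bend points of the composite diagram: those of `T`, those of the `S j`, and,
for each of the four points on the boundary of the `j`-th hole of `T`, the end from `T` (`false`)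
and the end from `S j` (`true`), which now meet there. -/
abbrev FillBend (T : TangleCode n) (S : ∀ j, TangleCode (k j)) : Type :=
  (T.Bend ⊕ Σ j, (S j).Bend) ⊕ (Fin n × Fin 4) × Bool

/-- The crossings of the composite diagram. -/
abbrev FillCrossing (T : TangleCode n) (S : ∀ j, TangleCode (k j)) : Type :=
  T.Crossing ⊕ Σ j, (S j).Crossing

/-- The edge ends of the composite diagram. -/
abbrev FillDart (T : TangleCode n) (S : ∀ j, TangleCode (k j)) : Type :=
  (FillBend T S ⊕ Option (Fin (∑ j, k j)) × Fin 4) ⊕ FillCrossing T S × Fin 4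

/-- The edge ends of the composite diagram are those of `T` and those of the `S j`. The outer
circle is that of `T`; the holes are those of `S 0`, then those of `S 1`, and so on. -/
def fillEquiv (T : TangleCode n) (S : ∀ j, TangleCode (k j)) :
    FillDart T S ≃ T.Dart ⊕ Σ j, (S j).Dart where
  toFun
    | .inl (.inl (.inl (.inl x))) => .inl (.inl (.inl x))
    | .inl (.inl (.inl (.inr ⟨j, x⟩))) => .inr ⟨j, .inl (.inl x)⟩
    | .inl (.inl (.inr ((j, i), false))) => .inl (.inl (.inr (some j, i)))
    | .inl (.inl (.inr ((j, i), true))) => .inr ⟨j, .inl (.inr (none, i))⟩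
    | .inl (.inr (none, i)) => .inl (.inl (.inr (none, i)))
    | .inl (.inr (some h, i)) =>
        .inr ⟨(finSigmaFinEquiv.symm h).1, .inl (.inr (some (finSigmaFinEquiv.symm h).2, i))⟩
    | .inr (.inl c, i) => .inl (.inr (c, i))
    | .inr (.inr ⟨j, c⟩, i) => .inr ⟨j, .inr (c, i)⟩
  invFun
    | .inl (.inl (.inl x)) => .inl (.inl (.inl (.inl x)))
    | .inl (.inl (.inr (none, i))) => .inl (.inr (none, i))
    | .inl (.inl (.inr (some j, i))) => .inl (.inl (.inr ((j, i), false)))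
    | .inl (.inr (c, i)) => .inr (.inl c, i)
    | .inr ⟨j, .inl (.inl x)⟩ => .inl (.inl (.inl (.inr ⟨j, x⟩)))
    | .inr ⟨j, .inl (.inr (none, i))⟩ => .inl (.inl (.inr ((j, i), true)))
    | .inr ⟨j, .inl (.inr (some l, i))⟩ => .inl (.inr (some (finSigmaFinEquiv ⟨j, l⟩), i))
    | .inr ⟨j, .inr (c, i)⟩ => .inr (.inr ⟨j, c⟩, i)
  left_inv := by
    rintro ((((x | ⟨j, x⟩) | ⟨⟨j, i⟩, _ | _⟩) | ⟨_ | h, i⟩) | ⟨c | ⟨j, c⟩, i⟩) <;> simp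
  right_inv := by
    rintro (((x | ⟨_ | j, i⟩) | ⟨c, i⟩) | ⟨j, (x | ⟨_ | l, i⟩) | ⟨c, i⟩⟩)
    case inr.inl.inr.some =>
      exact congrArg (fun p : Σ j, Fin (k j) =>
        (.inr ⟨p.1, .inl (.inr (some p.2, i))⟩ : T.Dart ⊕ Σ j, (S j).Dart))
        (finSigmaFinEquiv.symm_apply_apply ⟨j, l⟩)
    all_goals simp

/-- The composite `T(S 0, S 1, …)`: the `j`-th hole of `T` is filled by `S j`, the point `i` on
the boundary of the hole being identified with the point `i` on the outer circle of `S j`. -/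
def TangleCode.fill (T : TangleCode n) (S : ∀ j, TangleCode (k j)) :
    TangleCode (∑ j, k j) where
  Bend := FillBend T S
  Crossing := FillCrossing T S
  bend := Equiv.sumCongr
    (Equiv.sumCongr T.bend (Equiv.sigmaCongrRight fun j => (S j).bend))
    (Equiv.prodCongrRight fun _ => Equiv.boolNot)
  bend_invol := by
    rintro ((x | ⟨j, x⟩) | ⟨x, b⟩) <;> simp [TangleCode.bend_invol]
  bend_ne := by
    rintro ((x | ⟨j, x⟩) | ⟨x, b⟩) <;> simp [TangleCode.bend_ne]
  edge := (fillEquiv T S).trans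
    ((Equiv.sumCongr T.edge (Equiv.sigmaCongrRight fun j => (S j).edge)).trans
      (fillEquiv T S).symm)
  edge_invol := by
    intro x
    rcases h : fillEquiv T S x with y | ⟨j, y⟩ <;>
      simp [h, TangleCode.edge_invol, Equiv.symm_apply_eq]
  edge_ne := by
    intro x
    rcases h : fillEquiv T S x with y | ⟨j, y⟩ <;>
      simp [h, TangleCode.edge_ne, Equiv.symm_apply_eq]

end fill

/-! ### The matrix of dictionary-ordered products -/

/-- The dictionary order function `ξ`, with values indexed by `1, …, 2^(k_1 + ⋯ + k_n)`: its
entries are the products `∏ j, v^j_{α_j}`, where `α` runs through `∏ j, {1, …, 2 ^ k j}` in the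
dictionary order. -/
def xi {n : ℕ} (k : Fin n → ℕ) (v : ∀ j, Fin (2 ^ k j) → ℤ) (l : Fin (2 ^ ∑ j, k j)) : ℤ :=
  ∏ j, v j (dictPow k l j)

/-- The `2^n × 2^(k_1 + ⋯ + k_n)` matrix `η^n(b^1, …, b^n)`, whose `i`-th row is `ξ` of the rows
number `α_{i1}, …, α_{in}` of `b^1, …, b^n`, with `α_i` the `i`-th element of `{1, 2}^n`. -/
def eta {n : ℕ} (k : Fin n → ℕ) (b : ∀ j, Matrix (Fin 2) (Fin (2 ^ k j)) ℤ) :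
    Matrix (Fin (2 ^ n)) (Fin (2 ^ ∑ j, k j)) ℤ :=
  Matrix.of fun i => xi k fun j => b j (dictTwo n i j)

theorem eta_apply {n : ℕ} (k : Fin n → ℕ) (b : ∀ j, Matrix (Fin 2) (Fin (2 ^ k j)) ℤ)
    (i : Fin (2 ^ n)) (l : Fin (2 ^ ∑ j, k j)) :
    eta k b i l = ∏ j, b j (dictTwo n i j) (dictPow k l j) := rfl

end PuncturedTangle

end

open PuncturedTangle

/-! At `root8` the loop value `-a ^ 2 - a⁻¹ ^ 2` vanishes, so the bracket only counts, with weights,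
the states whose resolution is a single circle. The formula reduces to a statement about one state
of the composite (`loops_fill_eq_one`). Such a state restricts to a state of `T` and a state of each
`S j`. Of the two closures of `S j`, one, say `a j`, has exactly one circle fewer than the other.
Apart from its closed circles, `S j` then connects its four outer points as the fundamental tangle
`a j` does, so filling with `S j` amounts to filling with `a j` and adding these circles. Counting
(`numOrbits_fill`) gives `loops (fill) + n = loops (T, a) + ∑ j, loops (S j, a j)`. All terms on the
right are positive, so the composite has one circle exactly when each of them is `1`; any other
choice of closures gives some `S j` at least two circles and contributes `0`. Summing over states
gives `bracket_fill`, and the powers of `I` in the two rows and in the columns combine to the matrix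
product `A * eta k b`.

That changing one smoothing changes the number of circles by exactly one, never by zero, is where
planarity enters. A plane diagram has a colouring of its edge ends that alternates along edges and
around vertices (`exists_isColouring`): by the genus inequality `defect_nonneg`, a double cover of
the sphere is disconnected. With such a colouring, circles become cycles of one permutation on the
points of one colour (`halfPerm`), and changing a smoothing multiplies that permutation by a
transposition.

The same fact gives integrality: the parity of the number of circles is determined by how many
vertices have the smoothing `pair01`, so on single-circle states all weights agree up to sign after
one normalisation (`exists_parity`, `exists_mem_invariant`). Two integer normalisations differ by a
real eighth root of unity, hence by a sign (`invariant_eq_projClass`). Planarity of the composite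
follows from the genus inequality, since gluing does not increase genus (`isPlanar_fill`). -/

noncomputable section

namespace PuncturedTangle

open Relation Equiv

/-! ### Merging two classes of a quotient -/

section merge

variable {X : Type} {r r' : X → X → Prop} {a b : X}

/-- `x` lies in the class of `a` or in the class of `b`. -/
def NearPair (r : X → X → Prop) (a b x : X) : Prop := EqvGen r x a ∨ EqvGen r x b

theorem NearPair.trans {x y : X} (h : EqvGen r x y) (hy : NearPair r a b y) :
    NearPair r a b x :=
  hy.imp (h.trans _ _ _) (h.trans _ _ _)

/-- The hypotheses say that the steps of `r'` generate those of `r`, and that any new step stays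
inside the union of the classes of `a` and `b`. Hence these two classes are united and all others
are unchanged. -/
theorem eqvGen_merge (hab : EqvGen r' a b)
    (h1 : ∀ x y, r x y → EqvGen r' x y)
    (h2 : ∀ x y, r' x y → EqvGen r x y ∨ (NearPair r a b x ∧ NearPair r a b y)) (x y : X) :
    EqvGen r' x y ↔ EqvGen r x y ∨ (NearPair r a b x ∧ NearPair r a b y) := by
  have up : ∀ {x y}, EqvGen r x y → EqvGen r' x y := by
    intro x y h
    induction h with
    | rel x y h => exact h1 x y h
    | refl x => exact .refl x
    | symm x y _ ih => exact ih.symm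
    | trans x y z _ _ ih ih' => exact ih.trans _ _ _ ih'
  constructor
  · intro h
    induction h with
    | rel x y h => exact h2 x y h
    | refl x => exact .inl (.refl x)
    | symm x y _ ih => exact ih.imp (.symm _ _) And.symm
    | trans x y z _ _ ih ih' =>
      rcases ih with h | ⟨hx, hy⟩ <;> rcases ih' with h' | ⟨hy', hz⟩
      · exact .inl (h.trans _ _ _ h')
      · exact .inr ⟨.trans h hy', hz⟩
      · exact .inr ⟨hx, .trans (h'.symm _ _) hy⟩
      · exact .inr ⟨hx, hz⟩
  · have near : ∀ {x}, NearPair r a b x → EqvGen r' x a := fun h =>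
      h.elim up fun h => (up h).trans _ _ _ (hab.symm _ _)
    rintro (h | ⟨hx, hy⟩)
    · exact up h
    · exact (near hx).trans _ _ _ ((near hy).symm _ _)

theorem card_quot_merge [Finite X] (hnab : ¬ EqvGen r a b) (hab : EqvGen r' a b)
    (h1 : ∀ x y, r x y → EqvGen r' x y)
    (h2 : ∀ x y, r' x y → EqvGen r x y ∨ (NearPair r a b x ∧ NearPair r a b y)) :
    Nat.card (Quot r') + 1 = Nat.card (Quot r) := by
  classical
  have key := eqvGen_merge hab h1 h2
  -- The class of `b` goes to `none` and every other class to its image, so the class of `a`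
  -- represents the united class.
  let f : Quot r → Option (Quot r') := fun q =>
    if q = Quot.mk r b then none
    else some (Quot.lift (Quot.mk r') (fun x y h => Quot.eqvGen_sound (h1 x y h)) q)
  have hf : Function.Bijective f := by
    constructor
    · rintro ⟨x⟩ ⟨y⟩ h
      simp only [f] at h
      split_ifs at h with hx hy hy
      · exact hx.trans hy.symm
      · simp only [Option.some.injEq] at h
        have hx' : ¬ EqvGen r x b := fun h => hx (Quot.eqvGen_sound h)
        have hy' : ¬ EqvGen r y b := fun h => hy (Quot.eqvGen_sound h)
        rcases (key x y).1 (Quot.eqvGen_exact h) with h | ⟨h, h'⟩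
        · exact Quot.eqvGen_sound h
        · exact Quot.eqvGen_sound
            ((h.resolve_right hx').trans _ _ _ ((h'.resolve_right hy').symm _ _))
    · rintro (_ | ⟨⟨x⟩⟩)
      · exact ⟨Quot.mk r b, by simp [f]⟩
      · by_cases hx : Quot.mk r x = Quot.mk r b
        · refine ⟨Quot.mk r a, ?_⟩
          have ha : Quot.mk r a ≠ Quot.mk r b := fun h => hnab (Quot.eqvGen_exact h)
          simp only [f, ha, if_false, Option.some.injEq]
          exact Quot.eqvGen_sound ((key a x).2
            (.inr ⟨.inl (.refl a), .inr (Quot.eqvGen_exact hx)⟩))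
        · exact ⟨Quot.mk r x, by simp [f, hx]⟩
  rw [Nat.card_congr (Equiv.ofBijective f hf), Finite.card_option]

theorem card_quot_eq_of_eqvGen_iff {r r' : X → X → Prop}
    (h : ∀ x y, EqvGen r x y ↔ EqvGen r' x y) : Nat.card (Quot r) = Nat.card (Quot r') :=
  Nat.card_congr
    { toFun := Quot.lift (Quot.mk r') fun x y hxy => Quot.eqvGen_sound ((h x y).1 (.rel _ _ hxy))
      invFun := Quot.lift (Quot.mk r) fun x y hxy => Quot.eqvGen_sound ((h x y).2 (.rel _ _ hxy))
      left_inv := by rintro ⟨x⟩; rfl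
      right_inv := by rintro ⟨x⟩; rfl }

end merge

/-! ### Cycles of permutations -/

section cycles

variable {X : Type} (p : Perm X)

theorem eqvGen_apply_iff_sameCycle (x y : X) :
    EqvGen (fun x y => p x = y) x y ↔ p.SameCycle x y := by
  constructor
  · intro h
    induction h with
    | rel x y h => subst h; exact Perm.sameCycle_apply_right.2 (.refl _ _)
    | refl x => exact .refl _ _
    | symm x y _ ih => exact ih.symm
    | trans x y z _ _ ih ih' => exact ih.trans ih'
  · rintro ⟨k, rfl⟩
    induction k using Int.induction_on with
    | zero => exact .refl _
    | succ k ih =>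
      refine ih.trans _ _ _ (.rel _ _ ?_)
      rw [add_comm, zpow_add]; rfl
    | pred k ih =>
      refine ih.trans _ _ _ (.symm _ _ (.rel _ _ ?_))
      have : (-(k : ℤ)) = 1 + (-(k : ℤ) - 1) := by ring
      conv_rhs => rw [this, zpow_add]
      rfl

variable [DecidableEq X] {p} {x y : X}

/-- The new orbit of `x` follows `p` until `p` would return to `x`, and there it is diverted to `y`.
-/
theorem sameCycle_swap_mul_of_not [Finite X] (h : ¬ p.SameCycle x y) :
    (swap x y * p).SameCycle x y := by
  obtain ⟨k, hk0, hk, -⟩ :=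
    (Perm.SameCycle.refl p x).exists_pow_eq''.imp fun k h => (⟨h.1, h.2.2, h.2.1⟩ : _ ∧ _ ∧ _)
  classical
  have hex : ∃ k, 0 < k ∧ (p ^ k) x = x := ⟨k, hk0, hk⟩
  obtain ⟨hm0, hm⟩ := Nat.find_spec hex
  set m := Nat.find hex
  have hmin : ∀ i, 0 < i → i < m → (p ^ i) x ≠ x := fun i h0 hi h =>
    Nat.find_min hex hi ⟨h0, h⟩
  have hne : ∀ i, (p ^ i) x ≠ y := fun i hi => h (hi ▸ ⟨i, by simp⟩)
  have step : ∀ i, i < m → ((swap x y * p) ^ i) x = (p ^ i) x := by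
    intro i
    induction i with
    | zero => simp
    | succ i ih =>
      intro hi
      rw [pow_succ', Perm.mul_apply, ih (by omega), Perm.mul_apply, ← Perm.mul_apply p, ← pow_succ']
      exact swap_apply_of_ne_of_ne (hmin _ (by omega) hi) (hne _)
  obtain ⟨j, hj⟩ : ∃ j, m = j + 1 := ⟨m - 1, by omega⟩
  refine ⟨m, ?_⟩
  rw [zpow_natCast, hj, pow_succ', Perm.mul_apply, step j (by omega), Perm.mul_apply,
    ← Perm.mul_apply p, ← pow_succ', ← hj, hm, swap_apply_left]

/-- The new orbit of `x` follows `p` until `p` would first reach `y`, and there it is sent back to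
`x`; it is trapped in the initial segment before `y`. -/
theorem not_sameCycle_swap_mul [Finite X] (hxy : x ≠ y) (h : p.SameCycle x y) :
    ¬ (swap x y * p).SameCycle x y := by
  classical
  obtain ⟨k, -, -, hk⟩ := h.exists_pow_eq''
  have hex : ∃ k, (p ^ k) x = y := ⟨k, hk⟩
  have hm := Nat.find_spec hex
  set m := Nat.find hex
  have hmin : ∀ i, i < m → (p ^ i) x ≠ y := fun i hi h => Nat.find_min hex hi h
  have hm0 : 0 < m := Nat.pos_of_ne_zero fun h0 => hxy (by rw [h0] at hm; simpa using hm)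
  have inv : ∀ n : ℕ, ∃ i < m, ((swap x y * p) ^ n) x = (p ^ i) x := by
    intro n
    induction n with
    | zero => exact ⟨0, hm0, rfl⟩
    | succ n ih =>
      obtain ⟨i, hi, e⟩ := ih
      rw [pow_succ', Perm.mul_apply, e, Perm.mul_apply, ← Perm.mul_apply p, ← pow_succ']
      rcases eq_or_ne (i + 1) m with h1 | h1
      · exact ⟨0, hm0, by rw [h1, hm, swap_apply_right]; rfl⟩
      -- A return to `x` before time `m` would let `p` reach `y` earlier than `m`.
      · by_cases h2 : (p ^ (i + 1)) x = x
        · exact absurd h2 <| by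
            intro h2
            have := hmin (m - (i + 1)) (by omega)
            apply this
            rw [← hm]
            conv_rhs => rw [show m = (m - (i + 1)) + (i + 1) by omega, pow_add, Perm.mul_apply, h2]
        · exact ⟨i + 1, by omega, swap_apply_of_ne_of_ne h2 (hmin _ (by omega))⟩
  intro hc
  obtain ⟨n, -, -, hn⟩ := hc.exists_pow_eq''
  obtain ⟨i, hi, e⟩ := inv n
  exact hmin i hi (e ▸ hn)

theorem sameCycle_swap_mul_merge [Finite X] (h : ¬ p.SameCycle x y) :
    (∀ u v, p u = v → EqvGen (fun u v => (swap x y * p) u = v) u v) ∧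
    (∀ u v, (swap x y * p) u = v → EqvGen (fun u v => p u = v) u v ∨
      (NearPair (fun u v => p u = v) x y u ∧ NearPair (fun u v => p u = v) x y v)) := by
  have hxy := (eqvGen_apply_iff_sameCycle _ _ _).2 (sameCycle_swap_mul_of_not h)
  constructor
  · rintro u v rfl
    by_cases h1 : p u = x
    · refine .trans _ y _ (.rel _ _ ?_) (by rw [h1]; exact hxy.symm)
      rw [Perm.mul_apply, h1, swap_apply_left]
    by_cases h2 : p u = y
    · refine .trans _ x _ (.rel _ _ ?_) (by rw [h2]; exact hxy)
      rw [Perm.mul_apply, h2, swap_apply_right]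
    · exact .rel _ _ (swap_apply_of_ne_of_ne h1 h2)
  · rintro u v rfl
    by_cases h1 : p u = x
    · refine .inr ⟨.inl (.rel _ _ h1), .inr ?_⟩
      rw [Perm.mul_apply, h1, swap_apply_left]; exact .refl _
    by_cases h2 : p u = y
    · refine .inr ⟨.inr (.rel _ _ h2), .inl ?_⟩
      rw [Perm.mul_apply, h2, swap_apply_right]; exact .refl _
    · exact .inl (.rel _ _ (swap_apply_of_ne_of_ne h1 h2).symm)

theorem numCycles_swap_mul_of_not [Finite X] (h : ¬ p.SameCycle x y) :
    numCycles (swap x y * p) + 1 = numCycles p := by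
  have hm := sameCycle_swap_mul_merge h
  exact card_quot_merge (mt (eqvGen_apply_iff_sameCycle _ _ _).1 h)
    ((eqvGen_apply_iff_sameCycle _ _ _).2 (sameCycle_swap_mul_of_not h)) hm.1 hm.2

theorem numCycles_swap_mul_of_sameCycle [Finite X] (hxy : x ≠ y) (h : p.SameCycle x y) :
    numCycles (swap x y * p) = numCycles p + 1 := by
  rw [← numCycles_swap_mul_of_not (not_sameCycle_swap_mul hxy h), swap_mul_self_mul]

end cycles

/-! ### Orbits of two permutations -/

section orbits

variable {X : Type}

/-- The relation whose classes are the orbits of the group generated by `e` and `s`. -/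
def Step (e s : Perm X) (x y : X) : Prop := e x = y ∨ s x = y

/-- `x` and `y` lie in the same orbit of the group generated by `e` and `s`. -/
def Linked (e s : Perm X) (x y : X) : Prop := EqvGen (Step e s) x y

/-- The number of orbits of the group generated by `e` and `s`. -/
def numOrbits (e s : Perm X) : ℕ := Nat.card (Quot (Step e s))

variable {e s : Perm X} {x y z : X}

theorem Linked.refl (x : X) : Linked e s x x := EqvGen.refl x
theorem Linked.symm (h : Linked e s x y) : Linked e s y x := EqvGen.symm _ _ h
theorem Linked.trans (h : Linked e s x y) (h' : Linked e s y z) : Linked e s x z :=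
  EqvGen.trans _ _ _ h h'
theorem Linked.fst (x : X) : Linked e s x (e x) := .rel _ _ (.inl rfl)
theorem Linked.snd (x : X) : Linked e s x (s x) := .rel _ _ (.inr rfl)

/-- A function that is constant along `e` and `s` is constant on orbits. -/
theorem Linked.map_eq {Y : Type} {f : X → Y} (he : ∀ x, f (e x) = f x) (hs : ∀ x, f (s x) = f x)
    (h : Linked e s x y) : f x = f y := by
  induction h with
  | rel x y h => rcases h with rfl | rfl <;> simp [he, hs]
  | refl x => rfl
  | symm x y _ ih => exact ih.symm
  | trans x y z _ _ ih ih' => exact ih.trans ih'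

theorem Linked.mono {e' s' : Perm X} (he : ∀ x, Linked e' s' x (e x))
    (hs : ∀ x, Linked e' s' x (s x)) (h : Linked e s x y) : Linked e' s' x y := by
  induction h with
  | rel x y h => rcases h with rfl | rfl <;> simp [he, hs]
  | refl x => exact .refl x
  | symm x y _ ih => exact ih.symm
  | trans x y z _ _ ih ih' => exact ih.trans ih'

theorem numOrbits_congr {e' s' : Perm X} (h : ∀ x y, Linked e s x y ↔ Linked e' s' x y) :
    numOrbits e s = numOrbits e' s' :=
  card_quot_eq_of_eqvGen_iff h

theorem Linked.of_sameCycle (h : s.SameCycle x y) : Linked e s x y := by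
  have := (eqvGen_apply_iff_sameCycle s x y).2 h
  exact this.mono fun u v h => .inr h

theorem Linked.of_sameCycle_mul (h : (s * e).SameCycle x y) : Linked e s x y := by
  have := (eqvGen_apply_iff_sameCycle _ x y).2 h
  clear h
  induction this with
  | rel x y h => subst h; exact (Linked.fst x).trans (.snd _)
  | refl x => exact .refl x
  | symm x y _ ih => exact ih.symm
  | trans x y z _ _ ih ih' => exact ih.trans ih'

theorem linked_swap_mul_merge [DecidableEq X] (h' : Linked e (swap x y * s) x y) :
    (∀ u v, Step e s u v → EqvGen (Step e (swap x y * s)) u v) ∧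
    (∀ u v, Step e (swap x y * s) u v → EqvGen (Step e s) u v ∨
      (NearPair (Step e s) x y u ∧ NearPair (Step e s) x y v)) := by
  constructor
  · rintro u v (rfl | rfl)
    · exact .rel _ _ (.inl rfl)
    by_cases h1 : s u = x
    · refine .trans _ y _ (.rel _ _ (.inr ?_)) (by rw [h1]; exact h'.symm)
      rw [Perm.mul_apply, h1, swap_apply_left]
    by_cases h2 : s u = y
    · refine .trans _ x _ (.rel _ _ (.inr ?_)) (by rw [h2]; exact h')
      rw [Perm.mul_apply, h2, swap_apply_right]
    · exact .rel _ _ (.inr (swap_apply_of_ne_of_ne h1 h2))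
  · rintro u v (rfl | rfl)
    · exact .inl (.rel _ _ (.inl rfl))
    by_cases h1 : s u = x
    · refine .inr ⟨.inl (.rel _ _ (.inr h1)), .inr ?_⟩
      rw [Perm.mul_apply, h1, swap_apply_left]; exact .refl _
    by_cases h2 : s u = y
    · refine .inr ⟨.inr (.rel _ _ (.inr h2)), .inl ?_⟩
      rw [Perm.mul_apply, h2, swap_apply_right]; exact .refl _
    · exact .inl (.rel _ _ (.inr (swap_apply_of_ne_of_ne h1 h2).symm))

theorem Linked.swap_mul_of_linked [DecidableEq X] (h : Linked e s x y)
    (h' : Linked e (swap x y * s) x y) (u v : X) : Linked e (swap x y * s) u v ↔ Linked e s u v := by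
  have key : ∀ (s : Perm X), Linked e s x y → ∀ u, Linked e s u (swap x y (s u)) := by
    intro s h u
    by_cases h1 : s u = x
    · rw [h1, swap_apply_left]; exact (h1 ▸ Linked.snd (e := e) u : Linked e s u x).trans h
    by_cases h2 : s u = y
    · rw [h2, swap_apply_right]; exact (h2 ▸ Linked.snd (e := e) u : Linked e s u y).trans h.symm
    · rw [swap_apply_of_ne_of_ne h1 h2]; exact .snd u
  constructor
  · exact Linked.mono .fst fun u => key s h u
  · refine Linked.mono .fst fun u => ?_
    simpa using key _ h' u

theorem numOrbits_one : numOrbits e 1 = numCycles e := by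
  refine card_quot_eq_of_eqvGen_iff fun x y => ⟨fun h => ?_, fun h => h.mono fun u v h => .inl h⟩
  induction h with
  | rel x y h =>
    rcases h with h | h
    · exact .rel _ _ h
    · rw [← h]; exact .refl x
  | refl x => exact .refl x
  | symm x y _ ih => exact ih.symm
  | trans x y z _ _ ih ih' => exact ih.trans _ _ _ ih'

theorem numCycles_one [Fintype X] : numCycles (1 : Perm X) = Fintype.card X := by
  rw [← Nat.card_eq_fintype_card]
  refine (Nat.card_congr (Equiv.ofBijective (Quot.mk _) ⟨fun x y h => ?_, Quot.mk_surjective⟩)).symm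
  exact Perm.sameCycle_one.1 ((eqvGen_apply_iff_sameCycle _ _ _).1 (Quot.eqvGen_exact h))

end orbits

/-! ### The genus inequality -/

section genus

variable {X : Type} [Fintype X]

/-- Twice the total genus of the map on a surface with rotation `s` and edges `e`. -/
def defect (e s : Perm X) : ℤ :=
  2 * numOrbits e s + Fintype.card X - numCycles s - numCycles e - numCycles (s * e)

variable [DecidableEq X] {e s : Perm X} {x y : X}

theorem numOrbits_swap_mul_of_not (h : ¬ Linked e s x y) :
    numOrbits e (swap x y * s) + 1 = numOrbits e s := by
  have hs : ¬ s.SameCycle x y := fun hc => h (.of_sameCycle hc)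
  have h' : Linked e (swap x y * s) x y := .of_sameCycle (sameCycle_swap_mul_of_not hs)
  have hm := linked_swap_mul_merge h'
  exact card_quot_merge h h' hm.1 hm.2

theorem defect_swap_mul_of_not_linked (h : ¬ Linked e s x y) :
    defect e (swap x y * s) = defect e s := by
  have h1 := numOrbits_swap_mul_of_not h
  have h2 := numCycles_swap_mul_of_not (p := s) fun hc => h (.of_sameCycle hc)
  have h3 := numCycles_swap_mul_of_not (p := s * e) fun hc => h (.of_sameCycle_mul hc)
  unfold defect
  rw [mul_assoc]
  omega

/-- Splitting a vertex adds one cycle to `s` and changes the number of faces by one. If the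
component survives, the defect drops by 0 or 2; if it falls apart, the step is the reverse of
joining two components, which preserves the defect. -/
theorem defect_swap_mul_le (hxy : x ≠ y) (h : s.SameCycle x y) :
    defect e (swap x y * s) ≤ defect e s := by
  by_cases h' : Linked e (swap x y * s) x y
  · have h1 : numOrbits e (swap x y * s) = numOrbits e s :=
      numOrbits_congr (Linked.swap_mul_of_linked (.of_sameCycle h) h')
    have h2 := numCycles_swap_mul_of_sameCycle hxy h
    have h3 : numCycles (s * e) ≤ numCycles (swap x y * (s * e)) + 1 := by
      by_cases hc : (s * e).SameCycle x y
      · have := numCycles_swap_mul_of_sameCycle hxy hc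
        omega
      · have := numCycles_swap_mul_of_not hc
        omega
    unfold defect
    rw [mul_assoc]
    omega
  · have := defect_swap_mul_of_not_linked h'
    rw [swap_mul_self_mul] at this
    exact this.ge

/-- Split off one edge end at a time until all vertices are trivial; the defect does not increase
and is `0` at `s = 1`. -/
theorem defect_nonneg (e s : Perm X) : 0 ≤ defect e s := by
  induction hn : s.support.card using Nat.strong_induction_on generalizing s with
  | _ n ih =>
    by_cases h1 : s = 1
    · subst h1
      unfold defect
      rw [numOrbits_one, numCycles_one, one_mul]
      omega
    · obtain ⟨x, hx⟩ : ∃ x, s x ≠ x := by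
        by_contra! h
        exact h1 (Perm.ext h)
      have h2 := Perm.card_support_swap_mul hx
      have h3 := ih _ (hn ▸ h2) (swap x (s x) * s) rfl
      exact h3.trans (defect_swap_mul_le hx.symm (Perm.sameCycle_apply_right.2 (.refl _ _)))

end genus

/-! ### Transport and disjoint unions -/

section unions

theorem numOrbits_equiv {X Y : Type} (f : X ≃ Y) {e s : Perm X} {e' s' : Perm Y}
    (he : ∀ x, f (e x) = e' (f x)) (hs : ∀ x, f (s x) = s' (f x)) :
    numOrbits e s = numOrbits e' s' := by
  refine Nat.card_congr (Quot.congr f fun x y => ?_)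
  simp only [Step, ← he, ← hs, f.injective.eq_iff]

theorem numCycles_equiv {X Y : Type} (f : X ≃ Y) {e : Perm X} {e' : Perm Y}
    (he : ∀ x, f (e x) = e' (f x)) : numCycles e = numCycles e' := by
  rw [← numOrbits_one, ← numOrbits_one]
  exact numOrbits_equiv f he fun _ => rfl

theorem numOrbits_sigma {ι : Type} [Fintype ι] {X : ι → Type} [∀ i, Finite (X i)]
    (e s : ∀ i, Perm (X i)) :
    numOrbits (Equiv.sigmaCongrRight e) (Equiv.sigmaCongrRight s) =
      ∑ i, numOrbits (e i) (s i) := by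
  have lift : ∀ i x y, Step (e i) (s i) x y →
      Step (Equiv.sigmaCongrRight e) (Equiv.sigmaCongrRight s) ⟨i, x⟩ ⟨i, y⟩ := by
    rintro i x y (rfl | rfl)
    · exact .inl rfl
    · exact .inr rfl
  let f : Quot (Step (Equiv.sigmaCongrRight e) (Equiv.sigmaCongrRight s)) ≃
      Σ i, Quot (Step (e i) (s i)) :=
    { toFun := Quot.lift (fun x => ⟨x.1, Quot.mk _ x.2⟩) (by
        rintro ⟨i, x⟩ _ (rfl | rfl)
        · exact congrArg (Sigma.mk i) (Quot.sound (.inl rfl))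
        · exact congrArg (Sigma.mk i) (Quot.sound (.inr rfl)))
      invFun := fun q => Quot.lift (fun x => Quot.mk _ ⟨q.1, x⟩)
        (fun x y h => Quot.sound (lift _ _ _ h)) q.2
      left_inv := by rintro ⟨⟨i, x⟩⟩; rfl
      right_inv := by rintro ⟨i, ⟨x⟩⟩; rfl }
  rw [numOrbits, Nat.card_congr f, Nat.card_sigma]
  rfl

theorem numOrbits_sum {X Y : Type} [Finite X] [Finite Y] (e s : Perm X) (e' s' : Perm Y) :
    numOrbits (Equiv.sumCongr e e') (Equiv.sumCongr s s') = numOrbits e s + numOrbits e' s' := by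
  let f : Quot (Step (Equiv.sumCongr e e') (Equiv.sumCongr s s')) ≃
      Quot (Step e s) ⊕ Quot (Step e' s') :=
    { toFun := Quot.lift (Sum.map (Quot.mk _) (Quot.mk _)) (by
        rintro (x | x) _ (rfl | rfl)
        · exact congrArg Sum.inl (Quot.sound (.inl rfl))
        · exact congrArg Sum.inl (Quot.sound (.inr rfl))
        · exact congrArg Sum.inr (Quot.sound (.inl rfl))
        · exact congrArg Sum.inr (Quot.sound (.inr rfl)))
      invFun := Sum.elim
        (Quot.lift (fun x => Quot.mk _ (.inl x)) (by
          rintro x _ (rfl | rfl)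
          · exact Quot.sound (.inl rfl)
          · exact Quot.sound (.inr rfl)))
        (Quot.lift (fun x => Quot.mk _ (.inr x)) (by
          rintro x _ (rfl | rfl)
          · exact Quot.sound (.inl rfl)
          · exact Quot.sound (.inr rfl)))
      left_inv := by rintro ⟨x | x⟩ <;> rfl
      right_inv := by rintro (q | q) <;> induction q using Quot.ind <;> rfl }
  rw [numOrbits, Nat.card_congr f, Nat.card_sum]
  rfl

theorem numCycles_sigma {ι : Type} [Fintype ι] {X : ι → Type} [∀ i, Finite (X i)]
    (e : ∀ i, Perm (X i)) : numCycles (Equiv.sigmaCongrRight e) = ∑ i, numCycles (e i) := by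
  simp only [← numOrbits_one, ← numOrbits_sigma]
  rfl

theorem numCycles_sum {X Y : Type} [Finite X] [Finite Y] (e : Perm X) (e' : Perm Y) :
    numCycles (Equiv.sumCongr e e') = numCycles e + numCycles e' := by
  simp only [← numOrbits_one, ← numOrbits_sum]
  congr 1
  exact Equiv.ext fun x => by cases x <;> rfl

theorem defect_sum {X Y : Type} [Fintype X] [Fintype Y] (e s : Perm X) (e' s' : Perm Y) :
    defect (Equiv.sumCongr e e') (Equiv.sumCongr s s') = defect e s + defect e' s' := by
  have h : Equiv.sumCongr s s' * Equiv.sumCongr e e' = Equiv.sumCongr (s * e) (s' * e') :=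
    Equiv.ext fun x => by cases x <;> rfl
  unfold defect
  rw [h, numOrbits_sum, numCycles_sum, numCycles_sum, numCycles_sum, Fintype.card_sum]
  push_cast
  ring

theorem defect_sigma {ι : Type} [Fintype ι] {X : ι → Type} [∀ i, Fintype (X i)]
    (e s : ∀ i, Perm (X i)) :
    defect (Equiv.sigmaCongrRight e) (Equiv.sigmaCongrRight s) = ∑ i, defect (e i) (s i) := by
  have h : Equiv.sigmaCongrRight s * Equiv.sigmaCongrRight e =
    Equiv.sigmaCongrRight fun i => s i * e i := rfl
  unfold defect
  rw [h, numOrbits_sigma, numCycles_sigma, numCycles_sigma, numCycles_sigma, Fintype.card_sigma]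
  push_cast
  simp only [Finset.sum_sub_distrib, Finset.sum_add_distrib, Finset.mul_sum]

theorem defect_equiv {X Y : Type} [Fintype X] [Fintype Y] (f : X ≃ Y) {e s : Perm X}
    {e' s' : Perm Y} (he : ∀ x, f (e x) = e' (f x)) (hs : ∀ x, f (s x) = s' (f x)) :
    defect e s = defect e' s' := by
  unfold defect
  rw [numOrbits_equiv f he hs, numCycles_equiv f he, numCycles_equiv f hs,
    numCycles_equiv f (e := s * e) (e' := s' * e') fun x => by simp [he, hs],
    Fintype.card_congr f]

theorem numCycles_bool_prod {X : Type} [Finite X] (p : Perm X) :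
    numCycles (Equiv.prodCongr (Equiv.refl Bool) p) = 2 * numCycles p := by
  rw [← numCycles_equiv (Equiv.sigmaEquivProd Bool X) (e := Equiv.sigmaCongrRight fun _ => p)
    fun x => rfl, numCycles_sigma]
  simp

end unions

/-! ### Alternating two-colourings -/

section colouring

variable {X : Type}

/-- `e` is an involution that exchanges the two colours. -/
structure Alternating (c : X → Bool) (e : Perm X) : Prop where
  invol : ∀ x, e (e x) = x
  flip : ∀ x, c (e x) = !c x

theorem eq_or_eq_of_eqvGen_invol {e : Perm X} (h : ∀ x, e (e x) = x) {x y : X}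
    (hE : EqvGen (fun x y => e x = y) x y) : y = x ∨ y = e x := by
  induction hE with
  | rel u v huv => exact .inr huv.symm
  | refl u => exact .inl rfl
  | symm u v _ ih => exact ih.imp Eq.symm fun hu => by rw [hu, h]
  | trans u v w _ _ ih ih' =>
    rcases ih with rfl | rfl
    · exact ih'
    · rcases ih' with rfl | rfl
      · exact .inr rfl
      · exact .inl (h _)

theorem exists_flip_of_invol (e : Perm X) (h : ∀ x, e (e x) = x) (h' : ∀ x, e x ≠ x) :
    ∃ c : X → Bool, ∀ x, c (e x) = !c x := by
  classical
  let q : X → X := fun x => (Quot.mk (fun x y => e x = y) x).out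
  have hq : ∀ x, q (e x) = q x := fun x => congrArg Quot.out
    (Quot.sound (r := fun x y => e x = y) (a := x) (b := e x) rfl).symm
  have key : ∀ x, q x = x ∨ q x = e x := fun x =>
    eq_or_eq_of_eqvGen_invol h (Quot.eqvGen_exact (Quot.out_eq _).symm)
  refine ⟨fun x => decide (q x = x), fun x => ?_⟩
  rcases key x with hx | hx
  · simp [hq, hx, (h' x).symm]
  · simp [hq, hx, h' x]

/-- Every cycle of `e` is a pair with one point of each colour, so a point is determined by its
colour and its cycle. -/
theorem numCycles_of_invol [Fintype X] {c : X → Bool} {e : Perm X} (h : Alternating c e) :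
    2 * numCycles e = Fintype.card X := by
  let f : X → Bool × Quot (fun x y => e x = y) := fun x => (c x, Quot.mk _ x)
  have hf : Function.Bijective f := by
    constructor
    · intro x y hxy
      obtain ⟨h1, h2⟩ := Prod.mk.inj hxy
      rcases eq_or_eq_of_eqvGen_invol h.invol (Quot.eqvGen_exact h2) with rfl | rfl
      · rfl
      · simp [h.flip] at h1
    · rintro ⟨b, ⟨x⟩⟩
      by_cases hb : c x = b
      · exact ⟨x, by simp [f, hb]⟩
      · refine ⟨e x, Prod.ext ?_ (Quot.sound ?_)⟩
        · change c (e x) = b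
          rw [h.flip]
          cases b <;> simpa using hb
        · exact h.invol x
  rw [← Nat.card_eq_fintype_card, Nat.card_congr (Equiv.ofBijective f hf), Nat.card_prod]
  simp [numCycles]

/-- The lift of a permutation to the double cover that exchanges the two sheets. -/
def twist (p : Perm X) : Perm (Bool × X) := Equiv.prodCongr Equiv.boolNot p

theorem numCycles_twist [Finite X] {c : X → Bool} {p : Perm X} (h : ∀ x, c (p x) = !c x) :
    numCycles (twist p) = 2 * numCycles p := by
  -- Relabelling the sheets by the colour undoes the exchange of sheets along `p`.
  let f : Bool × X ≃ Bool × X :=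
    { toFun := fun x => (x.1 ^^ c x.2, x.2)
      invFun := fun x => (x.1 ^^ c x.2, x.2)
      left_inv := fun x => by simp
      right_inv := fun x => by simp }
  rw [← numCycles_bool_prod]
  refine numCycles_equiv f fun x => ?_
  simp [f, twist, h]

/-- In genus zero, if the vertices and the edges have even length, then the edge ends can be
coloured so that both permutations exchange the colours: the double cover of the sphere, branched
at no vertex, edge or face, is disconnected. -/
theorem exists_flip_of_defect_eq_zero [Fintype X] {e s : Perm X} (h0 : defect e s = 0)
    {c c' : X → Bool} (he : ∀ x, c (e x) = !c x) (hs : ∀ x, c' (s x) = !c' x) :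
    ∃ d : X → Bool, (∀ x, d (e x) = !d x) ∧ ∀ x, d (s x) = !d x := by
  classical
  have hmul : twist s * twist e = Equiv.prodCongr (Equiv.refl Bool) (s * e) :=
    Equiv.ext fun x => Prod.ext (by simp [twist]) rfl
  -- Vertices and edges lift to two cycles each because `s` and `e` flip colours; faces do so
  -- because two exchanges of sheets cancel. Doubling all counts against defect zero below leaves at
  -- least twice as many components above.
  have hcov := defect_nonneg (twist e) (twist s)
  unfold defect at h0 hcov
  rw [hmul, numCycles_twist he, numCycles_twist hs, numCycles_bool_prod, Fintype.card_prod,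
    Fintype.card_bool] at hcov
  have hle : 2 * numOrbits e s ≤ numOrbits (twist e) (twist s) := by
    push_cast at hcov
    omega
  have down : ∀ {x y}, Linked e s x y →
      ∃ t, ∀ b, Linked (twist e) (twist s) (b, x) (b ^^ t, y) := by
    intro x y h
    induction h with
    | rel x y h =>
      refine ⟨true, fun b => ?_⟩
      rw [Bool.xor_true]
      rcases h with rfl | rfl
      · exact .fst (b, x)
      · exact .snd (b, x)
    | refl x => exact ⟨false, fun b => by rw [Bool.xor_false]; exact .refl _⟩
    | symm x y _ ih =>
      obtain ⟨t, ht⟩ := ih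
      exact ⟨t, fun b => by simpa using (ht (b ^^ t)).symm⟩
    | trans x y z _ _ ih ih' =>
      obtain ⟨t, ht⟩ := ih
      obtain ⟨t', ht'⟩ := ih'
      exact ⟨t ^^ t', fun b => by simpa using (ht b).trans (ht' _)⟩
  let o : X → X := fun x => (Quot.mk (Step e s) x).out
  -- `t x` is the change of sheet along a lifted path from `x` to the representative of its
  -- component.
  choose t ht using fun x => down (Quot.eqvGen_exact (Quot.out_eq (Quot.mk (Step e s) x)).symm)
  let g : Bool × Quot (Step e s) → Quot (Step (twist e) (twist s)) :=
    fun q => Quot.mk _ (q.1, q.2.out)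
  have hsurj : Function.Surjective g := by
    rintro ⟨b, x⟩
    exact ⟨(b ^^ t x, Quot.mk _ x), (Quot.eqvGen_sound (ht x b)).symm⟩
  -- There are enough components above for the two sheets over a representative to lie in different
  -- ones, so `t` does not depend on the path.
  have hinj : Function.Injective g := by
    refine (Function.Surjective.bijective_of_nat_card_le hsurj ?_).1
    rw [Nat.card_prod, Nat.card_eq_fintype_card, Fintype.card_bool]
    exact hle
  have huniq : ∀ x b b', Linked (twist e) (twist s) (b, x) (b', o x) → b' = (b ^^ t x) :=
    fun x b b' h => congrArg Prod.fst (@hinj (b', Quot.mk _ x) (b ^^ t x, Quot.mk _ x)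
      (Quot.eqvGen_sound (h.symm.trans (ht x b))))
  have flip : ∀ (p : Perm X) x, Linked e s x (p x) →
      Linked (twist e) (twist s) (true, x) (false, p x) → t (p x) = !t x := by
    intro p x h1 h2
    have h3 := h2.trans (ht (p x) false)
    rw [← Quot.eqvGen_sound h1] at h3
    simpa using huniq x _ _ h3
  exact ⟨t, fun x => flip e x (.fst x) (.fst (true, x)),
    fun x => flip s x (.snd x) (.snd (true, x))⟩

/-! ### Surgery on alternating matchings -/

theorem Alternating.conj_swap [DecidableEq X] {c : X → Bool} {s : Perm X} (h : Alternating c s)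
    {a b : X} (hab : c a = c b) : Alternating c (swap a b * s * swap a b) := by
  have hc : ∀ x, c (swap a b x) = c x := by
    intro x
    rw [swap_apply_def]
    split_ifs with h1 h2
    · rw [h1, hab]
    · rw [h2, hab]
    · rfl
  exact ⟨fun x => by simp [h.invol], fun x => by simp [hc, h.flip]⟩

section surgery

variable {c : X → Bool} {e s : Perm X} (he : Alternating c e) (hs : Alternating c s)

/-- Going once along both involutions, on the points of one colour. -/
def halfPerm (k : Bool) : Perm {x // c x = k} :=
  (s * e).subtypePerm fun x => by simp [he.flip, hs.flip]

theorem halfPerm_coe (k : Bool) (x : {x // c x = k}) :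
    (halfPerm he hs k x : X) = s (e x) := rfl

/-- Every orbit meets the points of one colour in a cycle. -/
def orbitEquiv (k : Bool) : Quot (Step e s) ≃ Quot fun x y => halfPerm he hs k x = y where
  toFun := Quot.lift (fun x => if h : c x = k then Quot.mk _ ⟨x, h⟩ else
      Quot.mk _ ⟨s x, by rw [hs.flip]; cases k <;> simpa using h⟩) (by
    -- A point of the wrong colour may be replaced by either neighbour, since `halfPerm` carries `e
    -- x` to `s x`.
    have key : ∀ x (h : ¬ c x = k) h' h'',
        (Quot.mk (fun x y => halfPerm he hs k x = y) ⟨s x, h'⟩) =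
          Quot.mk (fun x y => halfPerm he hs k x = y) ⟨e x, h''⟩ := fun x h h' h'' =>
      (Quot.sound (r := fun x y => halfPerm he hs k x = y) (a := ⟨e x, h''⟩) (b := ⟨s x, h'⟩)
        (Subtype.ext (congrArg s (he.invol x)))).symm
    rintro x _ (rfl | rfl)
    · by_cases h : c x = k
      · have h' : ¬ c (e x) = k := by rw [he.flip, h]; simp
        rw [dif_pos h, dif_neg h']
        exact Quot.sound rfl
      · have h' : c (e x) = k := by rw [he.flip]; cases k <;> simpa using h
        rw [dif_neg h, dif_pos h']
        exact key x h _ _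
    · by_cases h : c x = k
      · have h' : ¬ c (s x) = k := by rw [hs.flip, h]; simp
        rw [dif_pos h, dif_neg h']
        congr 2
        exact (hs.invol x).symm
      · have h' : c (s x) = k := by rw [hs.flip]; cases k <;> simpa using h
        rw [dif_neg h, dif_pos h'])
  invFun := Quot.lift (fun x => Quot.mk _ x.1) (by
    rintro x _ rfl
    exact Quot.eqvGen_sound ((Linked.fst (x : X)).trans (.snd _)))
  left_inv := by
    rintro ⟨x⟩
    by_cases h : c x = k
    · simp [h]
    · simp only [h, dite_false]
      exact Quot.eqvGen_sound (Linked.snd x).symm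
  right_inv := by
    rintro ⟨x⟩
    simp [x.2]

theorem numOrbits_eq_numCycles_halfPerm (k : Bool) :
    numOrbits e s = numCycles (halfPerm he hs k) :=
  Nat.card_congr (orbitEquiv he hs k)

theorem linked_iff_sameCycle_halfPerm (k : Bool) (x y : {x // c x = k}) :
    Linked e s x y ↔ (halfPerm he hs k).SameCycle x y := by
  rw [← eqvGen_apply_iff_sameCycle, ← Quot.eq, Linked, ← Quot.eq,
    ← (orbitEquiv he hs k).apply_eq_iff_eq]
  simp [orbitEquiv, x.2, y.2]

variable [DecidableEq X] {a b : X} (hab : c a = c b)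

/-- For `x` of the colour of `a` and `b`, the point `e x` has the other colour, so the inner
transposition does nothing and only the outer one is seen. -/
theorem halfPerm_conj_swap :
    halfPerm he (hs.conj_swap hab) (c a) = swap ⟨a, rfl⟩ ⟨b, hab.symm⟩ * halfPerm he hs (c a) := by
  refine Equiv.ext fun x => Subtype.ext ?_
  have hx : c (e x) ≠ c a := by rw [he.flip, x.2]; simp
  rw [halfPerm_coe, Perm.mul_apply, Perm.mul_apply, swap_apply_of_ne_of_ne (x := e x)
    (fun h => hx (by rw [h])) (fun h => hx (by rw [h, hab])), Perm.mul_apply, swap_apply_def,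
    swap_apply_def]
  simp only [Subtype.ext_iff, halfPerm_coe]
  split_ifs <;> simp_all [halfPerm_coe]

include he hs hab

variable [Finite X]

theorem numOrbits_conj_swap_of_not_linked (h : ¬ Linked e s a b) :
    numOrbits e (swap a b * s * swap a b) + 1 = numOrbits e s := by
  rw [numOrbits_eq_numCycles_halfPerm he (hs.conj_swap hab) (c a), halfPerm_conj_swap he hs hab,
    numOrbits_eq_numCycles_halfPerm he hs (c a)]
  exact numCycles_swap_mul_of_not fun hc =>
    h ((linked_iff_sameCycle_halfPerm he hs (c a) ⟨a, rfl⟩ ⟨b, hab.symm⟩).2 hc)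

theorem linked_conj_swap_of_not_linked (h : ¬ Linked e s a b) :
    Linked e (swap a b * s * swap a b) a b := by
  refine (linked_iff_sameCycle_halfPerm he (hs.conj_swap hab) (c a) ⟨a, rfl⟩ ⟨b, hab.symm⟩).2 ?_
  rw [halfPerm_conj_swap he hs hab]
  exact sameCycle_swap_mul_of_not fun hc =>
    h ((linked_iff_sameCycle_halfPerm he hs (c a) ⟨a, rfl⟩ ⟨b, hab.symm⟩).2 hc)

theorem linked_conj_swap_iff (h : ¬ Linked e s a b) (x y : X) :
    Linked e (swap a b * s * swap a b) x y ↔ Linked e s x y ∨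
      ((Linked e s x a ∨ Linked e s x b) ∧ (Linked e s y a ∨ Linked e s y b)) := by
  have h' := linked_conj_swap_of_not_linked he hs hab h
  refine eqvGen_merge h' ?_ ?_ x y
  · have hsw : ∀ x, Linked e (swap a b * s * swap a b) x (swap a b x) := by
      intro x
      rw [swap_apply_def]
      split_ifs with h1 h2
      · rw [h1]; exact h'
      · rw [h2]; exact h'.symm
      · exact .refl x
    rintro x _ (rfl | rfl)
    · exact Linked.fst x
    · refine (hsw x).trans (Linked.trans (.snd _) ?_)
      simpa using (hsw (s x)).symm
  · rintro x _ (rfl | rfl)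
    · exact .inl (Linked.fst x)
    rw [Perm.mul_apply, Perm.mul_apply]
    have near : ∀ {x y}, NearPair (Step e s) a b x → Linked e s x y →
        NearPair (Step e s) a b (swap a b y) := by
      intro x y hx hy
      rw [swap_apply_def]
      split_ifs
      · exact .inr (.refl b)
      · exact .inl (.refl a)
      · exact .trans hy.symm hx
    by_cases h1 : x = a
    · subst h1
      refine .inr ⟨.inl (.refl x), near (.inr (.refl b)) ?_⟩
      rw [swap_apply_left]
      exact .snd b
    by_cases h2 : x = b
    · subst h2
      refine .inr ⟨.inr (.refl x), near (.inl (.refl a)) ?_⟩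
      rw [swap_apply_right]
      exact .snd a
    rw [swap_apply_of_ne_of_ne h1 h2]
    by_cases h3 : s x = a ∨ s x = b
    · have hx : NearPair (Step e s) a b x := h3.imp
        (fun h => .rel _ _ (.inr h)) (fun h => .rel _ _ (.inr h))
      exact .inr ⟨hx, near hx (.snd x)⟩
    · rw [not_or] at h3
      rw [swap_apply_of_ne_of_ne h3.1 h3.2]
      exact .inl (Linked.snd x)

theorem not_linked_conj_swap (hne : a ≠ b) (h : Linked e s a b) :
    ¬ Linked e (swap a b * s * swap a b) a b := by
  intro hc
  have := (linked_iff_sameCycle_halfPerm he (hs.conj_swap hab) (c a)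
    ⟨a, rfl⟩ ⟨b, hab.symm⟩).1 hc
  rw [halfPerm_conj_swap he hs hab] at this
  exact not_sameCycle_swap_mul (fun h => hne (Subtype.ext_iff.1 h))
    ((linked_iff_sameCycle_halfPerm he hs (c a) ⟨a, rfl⟩ ⟨b, hab.symm⟩).1 h) this

theorem numOrbits_conj_swap_of_linked (hne : a ≠ b) (h : Linked e s a b) :
    numOrbits e (swap a b * s * swap a b) = numOrbits e s + 1 := by
  rw [numOrbits_eq_numCycles_halfPerm he (hs.conj_swap hab) (c a), halfPerm_conj_swap he hs hab,
    numOrbits_eq_numCycles_halfPerm he hs (c a)]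
  exact numCycles_swap_mul_of_sameCycle (fun h => hne (Subtype.ext_iff.1 h))
    ((linked_iff_sameCycle_halfPerm he hs (c a) ⟨a, rfl⟩ ⟨b, hab.symm⟩).1 h)

end surgery

end colouring

/-! ### Gluing vertices of maps and of matchings -/

section gluing

theorem Linked.inv {X : Type} {e s : Perm X} {x y : X} {P : X → Prop}
    (he : ∀ x, P (e x) ↔ P x) (hs : ∀ x, P (s x) ↔ P x) (h : Linked e s x y) : P x ↔ P y :=
  iff_of_eq (h.map_eq (f := P) (fun x => propext (he x)) fun x => propext (hs x))

variable {X : Type} {e s : Perm X}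

/-- Joining two vertices of valency four in different components at their four ends does not
increase the genus. -/
theorem exists_glue_map [Fintype X] {t u : Fin 4 → X} (ht : Function.Injective t)
    (hu : Function.Injective u) (hst : ∀ i, s (t i) = t (i + 1)) (hsu : ∀ i, s (u i) = u (i - 1))
    (htu : ∀ i j, ¬ Linked e s (t i) (u j)) :
    ∃ s' : Perm X, defect e s' ≤ defect e s ∧ (∀ i, s' (t i) = u i) ∧ (∀ i, s' (u i) = t i) ∧
      ∀ x, (∀ i, x ≠ t i ∧ x ≠ u i) → s' x = s x := by
  classical
  have h1 : ∀ i j, t i ≠ u j := fun i j h => htu i j (h ▸ .refl _)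
  have h2 : ∀ i j, u j ≠ t i := fun i j h => h1 i j h.symm
  -- Each `swap (t (i + 1)) (u i)` redirects `t i` to `u i` and `u (i + 1)` to `t (i + 1)`. The
  -- first one joins the two components and makes a single cycle of length eight; the other three
  -- split cycles.
  set s1 := swap (t 1) (u 0) * s with hs1
  set s2 := swap (t 2) (u 1) * s1 with hs2
  set s3 := swap (t 3) (u 2) * s2 with hs3
  set s4 := swap (t 0) (u 3) * s3 with hs4
  have d1 : defect e s1 = defect e s := defect_swap_mul_of_not_linked (htu 1 0)
  have c1 : s1.SameCycle (t 2) (u 1) := by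
    have a : s1 (u 1) = t 1 := by simp [hs1, hsu]
    have b : s1 (t 1) = t 2 := by simp [hs1, hst, swap_apply_def, ht.eq_iff, h1]
    rw [← Perm.sameCycle_apply_right, a, ← Perm.sameCycle_apply_right, b]
  have d2 : defect e s2 ≤ defect e s1 := defect_swap_mul_le (h1 _ _) c1
  have c2 : s2.SameCycle (t 3) (u 2) := by
    have a : s2 (u 2) = t 2 := by
      simp [hs2, hs1, hsu, swap_apply_def, hu.eq_iff, h2]
    have b : s2 (t 2) = t 3 := by simp [hs2, hs1, hst, swap_apply_def, ht.eq_iff, h1]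
    rw [← Perm.sameCycle_apply_right, a, ← Perm.sameCycle_apply_right, b]
  have d3 : defect e s3 ≤ defect e s2 := defect_swap_mul_le (h1 _ _) c2
  have c3 : s3.SameCycle (t 0) (u 3) := by
    have a : s3 (u 3) = t 3 := by
      simp [hs3, hs2, hs1, hsu, swap_apply_def, hu.eq_iff, h2]
    have b : s3 (t 3) = t 0 := by simp [hs3, hs2, hs1, hst, swap_apply_def, ht.eq_iff, h1]
    rw [← Perm.sameCycle_apply_right, a, ← Perm.sameCycle_apply_right, b]
  have d4 : defect e s4 ≤ defect e s3 := defect_swap_mul_le (h1 _ _) c3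
  refine ⟨s4, by omega, fun i => ?_, fun i => ?_, fun x hx => ?_⟩
  · fin_cases i <;> simp [hs4, hs3, hs2, hs1, hst, swap_apply_def, ht.eq_iff, hu.eq_iff, h1, h2]
  · have h3 : (-1 : Fin 4) = 3 := rfl
    fin_cases i <;>
      simp [hs4, hs3, hs2, hs1, hsu, swap_apply_def, ht.eq_iff, hu.eq_iff, h1, h2, h3]
  · have k1 : ∀ i, s x ≠ t i := fun i h => (hx (i - 1)).1 <| s.injective <| by
      rw [h, hst, sub_add_cancel]
    have k2 : ∀ i, s x ≠ u i := fun i h => (hx (i + 1)).2 <| s.injective <| by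
      rw [h, hsu, add_sub_cancel_right]
    simp [hs4, hs3, hs2, hs1, swap_apply_def, k1, k2]

variable {ι : Type} {t u : ι → Fin 4 → X} (own : X → Option ι)

/-- Gluings at the indices in `J` leave every piece `k ∉ J` separate, which supplies the
disjointness needed to glue `k` next. -/
theorem own_glue_iff {s s' : Perm X} (ht : ∀ j i, own (t j i) = none)
    (hu : ∀ j i, own (u j i) = some j) (hown : ∀ x, own (s x) = own x) {J : Finset ι}
    (h1 : ∀ j ∈ J, ∀ i, s' (t j i) = u j i ∧ s' (u j i) = t j i)
    (h2 : ∀ x, (∀ j ∈ J, ∀ i, x ≠ t j i ∧ x ≠ u j i) → s' x = s x) {k : ι} (hk : k ∉ J) (x : X) :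
    own (s' x) = some k ↔ own x = some k := by
  by_cases hx : ∀ j ∈ J, ∀ i, x ≠ t j i ∧ x ≠ u j i
  · rw [h2 x hx, hown]
  · have : ∃ j ∈ J, ∃ i, x = t j i ∨ x = u j i := by
      by_contra! h
      exact hx h
    obtain ⟨j, hj, i, rfl | rfl⟩ := this
    · rw [(h1 j hj i).1, ht, hu]
      simp only [Option.some.injEq, reduceCtorEq, iff_false]
      rintro rfl
      exact hk hj
    · rw [(h1 j hj i).2, ht, hu]
      simp only [Option.some.injEq, reduceCtorEq, false_iff]
      rintro rfl
      exact hk hj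

theorem exists_glue_maps [Fintype X] (hti : ∀ j j' i i', t j i = t j' i' → j = j' ∧ i = i')
    (hui : ∀ j, Function.Injective (u j)) (ht : ∀ j i, own (t j i) = none)
    (hu : ∀ j i, own (u j i) = some j) (hoe : ∀ x, own (e x) = own x)
    (hos : ∀ x, own (s x) = own x)
    (hst : ∀ j i, s (t j i) = t j (i + 1)) (hsu : ∀ j i, s (u j i) = u j (i - 1))
    (J : Finset ι) :
    ∃ s' : Perm X, defect e s' ≤ defect e s ∧
      (∀ j ∈ J, ∀ i, s' (t j i) = u j i ∧ s' (u j i) = t j i) ∧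
      ∀ x, (∀ j ∈ J, ∀ i, x ≠ t j i ∧ x ≠ u j i) → s' x = s x := by
  classical
  have htu : ∀ j i j' i', t j i ≠ u j' i' := fun j i j' i' h => by
    have := congrArg own h
    rw [ht, hu] at this
    cases this
  have huu : ∀ j i j' i', u j i = u j' i' → j = j' := fun j i j' i' h => by
    have := congrArg own h
    rw [hu, hu] at this
    exact Option.some.inj this
  induction J using Finset.induction_on with
  | empty => exact ⟨s, le_rfl, by simp, fun _ _ => rfl⟩
  | insert k J hk ih =>
    obtain ⟨s1, hd, h1, h2⟩ := ih
    have hinv := own_glue_iff own ht hu hos h1 h2 hk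
    have hkt : ∀ i, ∀ j ∈ J, ∀ i', t k i ≠ t j i' ∧ t k i ≠ u j i' := fun i j hj i' =>
      ⟨fun h => hk ((hti _ _ _ _ h).1 ▸ hj), htu _ _ _ _⟩
    have hku : ∀ i, ∀ j ∈ J, ∀ i', u k i ≠ t j i' ∧ u k i ≠ u j i' := fun i j hj i' =>
      ⟨(htu _ _ _ _).symm, fun h => hk (huu _ _ _ _ h ▸ hj)⟩
    obtain ⟨s2, hd2, k1, k2, k3⟩ := exists_glue_map (e := e) (s := s1) (t := t k) (u := u k)
      (fun i i' h => (hti _ _ _ _ h).2) (hui k) (fun i => by rw [h2 _ (hkt i), hst])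
      (fun i => by rw [h2 _ (hku i), hsu])
      (fun i i' h => by
        have := h.inv (P := fun x => own x = some k) (fun x => by rw [hoe]) hinv
        rw [ht, hu] at this
        simp at this)
    refine ⟨s2, hd2.trans hd, fun j hj i => ?_, fun x hx => ?_⟩
    · rcases Finset.mem_insert.1 hj with rfl | hj
      · exact ⟨k1 i, k2 i⟩
      · rw [k3 _ fun i' => ⟨fun h => (hkt i' j hj i).1 h.symm, htu _ _ _ _⟩,
          k3 _ fun i' => ⟨(htu _ _ _ _).symm, fun h => (hku i' j hj i).2 h.symm⟩]
        exact h1 j hj i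
    · rw [k3 x (hx k (Finset.mem_insert_self _ _)),
        h2 x fun j hj => hx j (Finset.mem_insert_of_mem hj)]

/-- One of the two planar perfect matchings of four cyclically ordered points. -/
def IsPlanarMatching (p : Perm (Fin 4)) : Prop := p = pair01 ∨ p = pair12

/-- Two conjugations by transpositions replace the arcs `p` at `t` and at `u` by the four
connections `t i - u i`. The first joins a circle through `t` to one through `u`. The second again
joins two different circles, because `u 0` and `u 2` were on different ones, so two circles are lost
in all. -/
theorem exists_glue_matching [Finite X] {c : X → Bool} (he : Alternating c e)
    (hs : Alternating c s) {t u : Fin 4 → X} (ht : Function.Injective t)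
    (hu : Function.Injective u) (hc : ∀ i, c (u i) = !c (t i)) {p : Perm (Fin 4)}
    (hp : IsPlanarMatching p) (hst : ∀ i, s (t i) = t (p i)) (hsu : ∀ i, s (u i) = u (p i))
    (htu : ∀ i j, ¬ Linked e s (t i) (u j)) (huu : ¬ Linked e s (u 0) (u 2)) :
    ∃ s' : Perm X, Alternating c s' ∧ numOrbits e s' + 2 = numOrbits e s ∧
      (∀ i, s' (t i) = u i) ∧ (∀ i, s' (u i) = t i) ∧
      (∀ x, (∀ i, x ≠ t i ∧ x ≠ u i) → s' x = s x) ∧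
      ∀ x y, (∀ i, ¬ Linked e s x (t i) ∧ ¬ Linked e s x (u i)) → Linked e s' x y →
        Linked e s x y := by
  classical
  have h1 : ∀ i j, t i ≠ u j := fun i j h => htu i j (h ▸ .refl _)
  have h2 : ∀ i j, u j ≠ t i := fun i j h => h1 i j h.symm
  have hcp : ∀ i, c (t (p i)) = c (u i) := fun i => by rw [← hst, hs.flip, hc]
  -- The points `0` and `2` lie in different pairs of `p`, so these two conjugations treat one pair
  -- each; `t (p i)` and `u i` have the same colour.
  set s1 := swap (t (p 0)) (u 0) * s * swap (t (p 0)) (u 0) with hs1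
  set s2 := swap (t (p 2)) (u 2) * s1 * swap (t (p 2)) (u 2) with hs2
  have a1 : Alternating c s1 := hs.conj_swap (hcp 0)
  have l1 := linked_conj_swap_iff he hs (hcp 0) (htu (p 0) 0)
  have n1 := numOrbits_conj_swap_of_not_linked he hs (hcp 0) (htu (p 0) 0)
  rw [← hs1] at l1 n1
  have q : ¬ Linked e s1 (t (p 2)) (u 2) := by
    rw [l1]
    rintro (h | ⟨-, h | h⟩)
    · exact htu _ _ h
    · exact htu _ _ h.symm
    · exact huu h.symm
  have l2 := linked_conj_swap_iff he a1 (hcp 2) q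
  have n2 := numOrbits_conj_swap_of_not_linked he a1 (hcp 2) q
  rw [← hs2] at l2 n2
  refine ⟨s2, a1.conj_swap (hcp 2), by omega, fun i => ?_, fun i => ?_, fun x hx => ?_,
    fun x y hx h => ?_⟩
  · rcases hp with rfl | rfl <;> fin_cases i <;>
      simp [hs2, hs1, hst, hsu, swap_apply_def, ht.eq_iff, hu.eq_iff, h1, h2, pair01, pair12]
  · rcases hp with rfl | rfl <;> fin_cases i <;>
      simp [hs2, hs1, hst, hsu, swap_apply_def, ht.eq_iff, hu.eq_iff, h1, h2, pair01, pair12]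
  · have hpp : ∀ i, p (p i) = i := by
      rcases hp with rfl | rfl
      · exact pair01_invol
      · exact pair12_invol
    have k1 : ∀ i, s x ≠ t i := fun i h => (hx (p i)).1 <| s.injective <| by rw [h, hst, hpp]
    have k2 : ∀ i, s x ≠ u i := fun i h => (hx (p i)).2 <| s.injective <| by rw [h, hsu, hpp]
    simp [hs2, hs1, swap_apply_def, k1, k2, fun i => (hx i).1, fun i => (hx i).2]
  · have step : ∀ z, Linked e s1 x z → Linked e s x z := fun z h => by
      rcases (l1 _ _).1 h with h | ⟨h | h, -⟩
      · exact h
      · exact absurd h (hx _).1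
      · exact absurd h (hx _).2
    rcases (l2 _ _).1 h with h | ⟨h | h, -⟩
    · exact step _ h
    · exact absurd (step _ h) (hx _).1
    · exact absurd (step _ h) (hx _).2

/-- The separation of `u j 0` from `u j 2` for `j ∉ J` is carried along because the induction needs
it for the next gluing. -/
theorem exists_glue_matchings [Finite X] {c : X → Bool} (he : Alternating c e)
    (hs : Alternating c s) (hti : ∀ j j' i i', t j i = t j' i' → j = j' ∧ i = i')
    (hui : ∀ j, Function.Injective (u j)) (ht : ∀ j i, own (t j i) = none)
    (hu : ∀ j i, own (u j i) = some j) (hoe : ∀ x, own (e x) = own x)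
    (hos : ∀ x, own (s x) = own x) (hc : ∀ j i, c (u j i) = !c (t j i))
    {p : ι → Perm (Fin 4)} (hp : ∀ j, IsPlanarMatching (p j))
    (hst : ∀ j i, s (t j i) = t j (p j i)) (hsu : ∀ j i, s (u j i) = u j (p j i))
    (huu : ∀ j, ¬ Linked e s (u j 0) (u j 2)) (J : Finset ι) :
    ∃ s' : Perm X, Alternating c s' ∧ numOrbits e s' + 2 * J.card = numOrbits e s ∧
      (∀ j ∉ J, ¬ Linked e s' (u j 0) (u j 2)) ∧
      (∀ j ∈ J, ∀ i, s' (t j i) = u j i ∧ s' (u j i) = t j i) ∧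
      ∀ x, (∀ j ∈ J, ∀ i, x ≠ t j i ∧ x ≠ u j i) → s' x = s x := by
  classical
  have htu : ∀ j i j' i', t j i ≠ u j' i' := fun j i j' i' h => by
    have := congrArg own h
    rw [ht, hu] at this
    cases this
  have hjj : ∀ j i j' i', u j i = u j' i' → j = j' := fun j i j' i' h => by
    have := congrArg own h
    rw [hu, hu] at this
    exact Option.some.inj this
  induction J using Finset.induction_on with
  | empty => exact ⟨s, hs, by simp, fun j _ => huu j, by simp, fun _ _ => rfl⟩
  | insert k J hk ih =>
    obtain ⟨s1, ha, hn, hl, h1, h2⟩ := ih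
    have hinv : ∀ {k}, k ∉ J → ∀ {x y}, Linked e s1 x y → (own x = some k ↔ own y = some k) :=
      fun hk x y h => h.inv (P := fun x => own x = some _) (fun x => by rw [hoe])
        (own_glue_iff own ht hu hos h1 h2 hk)
    have hkt : ∀ i, ∀ j ∈ J, ∀ i', t k i ≠ t j i' ∧ t k i ≠ u j i' := fun i j hj i' =>
      ⟨fun h => hk ((hti _ _ _ _ h).1 ▸ hj), htu _ _ _ _⟩
    have hku : ∀ i, ∀ j ∈ J, ∀ i', u k i ≠ t j i' ∧ u k i ≠ u j i' := fun i j hj i' =>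
      ⟨(htu _ _ _ _).symm, fun h => hk (hjj _ _ _ _ h ▸ hj)⟩
    obtain ⟨s2, ha2, hn2, k1, k2, k3, k4⟩ := exists_glue_matching he ha (t := t k) (u := u k)
      (fun i i' h => (hti _ _ _ _ h).2) (hui k) (hc k) (hp k)
      (fun i => by rw [h2 _ (hkt i), hst]) (fun i => by rw [h2 _ (hku i), hsu])
      (fun i i' h => by simpa [ht, hu] using hinv hk h) (hl k hk)
    refine ⟨s2, ha2, ?_, fun j hj h => ?_, fun j hj i => ?_, fun x hx => ?_⟩
    · rw [Finset.card_insert_of_notMem hk]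
      omega
    · rw [Finset.mem_insert, not_or] at hj
      refine hl j hj.2 (k4 _ _ (fun i => ⟨fun h => ?_, fun h => ?_⟩) h)
      · simpa [ht, hu] using hinv hj.2 h
      · have := (hinv hj.2 h).1 (hu _ _)
        rw [hu] at this
        exact hj.1 (Option.some.inj this).symm
    · rcases Finset.mem_insert.1 hj with rfl | hj
      · exact ⟨k1 i, k2 i⟩
      · rw [k3 _ fun i' => ⟨fun h => (hkt i' j hj i).1 h.symm, htu _ _ _ _⟩,
          k3 _ fun i' => ⟨(htu _ _ _ _).symm, fun h => (hku i' j hj i).2 h.symm⟩]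
        exact h1 j hj i
    · rw [k3 x (hx k (Finset.mem_insert_self _ _)),
        h2 x fun j hj => hx j (Finset.mem_insert_of_mem hj)]

end gluing

/-! ### Colourings of planar tangle diagrams -/

/-- The parity of a point of `Fin 4`. -/
def parity (i : Fin 4) : Bool := decide (i.val % 2 = 1)

theorem parity_add_one : ∀ i, parity (i + 1) = !parity i := by decide
theorem parity_sub_one : ∀ i, parity (i - 1) = !parity i := by decide

theorem IsPlanarMatching.invol {p : Perm (Fin 4)} (hp : IsPlanarMatching p) (i : Fin 4) :
    p (p i) = i := by
  rcases hp with rfl | rfl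
  · exact pair01_invol i
  · exact pair12_invol i

theorem IsPlanarMatching.parity {p : Perm (Fin 4)} (hp : IsPlanarMatching p) :
    ∀ i, parity (p i) = !parity i := by
  rcases hp with rfl | rfl <;> decide

theorem isPlanarMatching_ite (P : Prop) [Decidable P] :
    IsPlanarMatching (if P then pair01 else pair12) := by
  split_ifs
  · exact .inl rfl
  · exact .inr rfl

namespace TangleCode

variable {n : ℕ} (T : TangleCode n)

/-- The vertices of valency four: the crossings and the boundary circles. -/
abbrev Vertex : Type := T.Crossing ⊕ Option (Fin n)

/-- The four edge ends at a vertex of valency four. -/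
def vertexDart : T.Vertex → Fin 4 → T.Dart
  | .inl c, i => .inr (c, i)
  | .inr o, i => .inl (.inr (o, i))

/-- The edge ends, sorted into those at bend points and those at vertices of valency four. -/
def dartEquiv : T.Dart ≃ T.Bend ⊕ T.Vertex × Fin 4 where
  toFun
    | .inl (.inl x) => .inl x
    | .inl (.inr (o, i)) => .inr (.inr o, i)
    | .inr (c, i) => .inr (.inl c, i)
  invFun
    | .inl x => .inl (.inl x)
    | .inr (v, i) => T.vertexDart v i
  left_inv := by rintro ((x | ⟨o, i⟩) | ⟨c, i⟩) <;> rfl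
  right_inv := by rintro (x | ⟨v | v, i⟩) <;> rfl

theorem dart_cases {P : T.Dart → Prop} (h1 : ∀ x, P (.inl (.inl x)))
    (h2 : ∀ v i, P (T.vertexDart v i)) : ∀ x, P x := by
  rintro ((x | ⟨o, i⟩) | ⟨c, i⟩)
  · exact h1 x
  · exact h2 (.inr o) i
  · exact h2 (.inl c) i

theorem vertexDart_injective {v w : T.Vertex} {i j : Fin 4}
    (h : T.vertexDart v i = T.vertexDart w j) : v = w ∧ i = j := by
  rcases v with v | v <;> rcases w with w | w <;>
    simp only [vertexDart, Sum.inl.injEq, Sum.inr.injEq, Prod.mk.injEq, reduceCtorEq] at h ⊢ <;>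
    exact h

/-- How edge ends are joined when each vertex `v` of valency four is replaced by the arcs
`0 - 1`, `2 - 3` (if `f v` is `true`) or `1 - 2`, `3 - 0` (if `f v` is `false`). -/
def smoothing (f : T.Vertex → Bool) : Perm T.Dart :=
  (T.dartEquiv.trans (Equiv.sumCongr T.bend
    (Equiv.prodCongrRight fun v => if f v = true then pair01 else pair12))).trans T.dartEquiv.symm

theorem smoothing_bend (f : T.Vertex → Bool) (x : T.Bend) :
    T.smoothing f (.inl (.inl x)) = .inl (.inl (T.bend x)) := rfl

theorem smoothing_vertex (f : T.Vertex → Bool) (v : T.Vertex) (i : Fin 4) :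
    T.smoothing f (T.vertexDart v i) =
      T.vertexDart v ((if f v = true then pair01 else pair12) i) := by
  rcases v with v | v <;> rfl

/-- The smoothing of all vertices that is given by a closure and a state. -/
def choice (r : Fin 2) (α : Fin n → Fin 2) (σ : T.Crossing → Bool) : T.Vertex → Bool :=
  Sum.elim σ fun o => o.elim (decide (r = 0)) fun j => decide (α j = 1)

theorem closure_join (r : Fin 2) (α : Fin n → Fin 2) (σ : T.Crossing → Bool) :
    (T.closure r α).join σ = T.smoothing (T.choice r α σ) := by
  refine Equiv.ext fun x => ?_
  rcases x with (x | ⟨_ | j, i⟩) | ⟨c, i⟩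
  · rfl
  · refine Eq.trans ?_ (T.smoothing_vertex _ (.inr none) i).symm
    simp only [choice, Sum.elim_inr, Option.elim_none, decide_eq_true_eq]
    rfl
  · refine Eq.trans ?_ (T.smoothing_vertex _ (.inr (some j)) i).symm
    simp only [choice, Sum.elim_inr, Option.elim_some, decide_eq_true_eq]
    have : (if α j = 1 then pair01 else pair12) = if α j = 0 then pair12 else pair01 := by
      generalize α j = a
      fin_cases a <;> rfl
    rw [this]
    rfl
  · rfl

theorem circles_closure (r : Fin 2) (α : Fin n → Fin 2) (σ : T.Crossing → Bool) :
    (T.closure r α).circles σ = numOrbits T.edge (T.smoothing (T.choice r α σ)) := by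
  rw [← closure_join]
  rfl

theorem numOrbits_pos (s : Perm T.Dart) : 0 < numOrbits T.edge s :=
  Nat.card_pos_iff.2 ⟨⟨Quot.mk _ (.inl (.inr (none, 0)))⟩, inferInstance⟩

theorem exists_alternating_edge : ∃ c, Alternating c T.edge :=
  (exists_flip_of_invol T.edge T.edge_invol T.edge_ne).imp fun _ h => ⟨T.edge_invol, h⟩

/-- Edges are pairs of ends, so `Fintype.card` of the ends is twice the number of edges and the
defect becomes `2 C - (V - E + F)`. -/
theorem isPlanar_iff : T.IsPlanar ↔ defect T.edge T.rot = 0 := by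
  obtain ⟨c, hc⟩ := T.exists_alternating_edge
  have h1 := numCycles_of_invol hc
  have h2 : T.numComponents = numOrbits T.edge T.rot := rfl
  unfold IsPlanar defect
  rw [h2]
  omega

/-- A colouring of the edge ends in which the colours alternate along edges, at bend points and
around every vertex. -/
structure IsColouring (c : T.Dart → Bool) : Prop where
  edge : Alternating c T.edge
  bend : ∀ x, c (.inl (.inl (T.bend x))) = !c (.inl (.inl x))
  vertex : ∀ v i, c (T.vertexDart v i) = (c (T.vertexDart v 0) ^^ parity i)

variable {T}

theorem exists_isColouring (h : T.IsPlanar) : ∃ c, T.IsColouring c := by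
  obtain ⟨c, hc⟩ := T.exists_alternating_edge
  obtain ⟨b, hb⟩ := exists_flip_of_invol T.bend T.bend_invol T.bend_ne
  -- This only witnesses that all cycles of `rot` have even length; it need not alternate along
  -- edges.
  let c' : T.Dart → Bool := Sum.elim (Sum.elim b fun x => parity x.2) fun x => parity x.2
  have hc' : ∀ x, c' (T.rot x) = !c' x := by
    rintro ((x | ⟨_ | j, i⟩) | ⟨c, i⟩)
    · exact hb x
    · exact parity_sub_one i
    · exact parity_add_one i
    · exact parity_add_one i
  obtain ⟨d, hde, hdr⟩ := exists_flip_of_defect_eq_zero (T.isPlanar_iff.1 h) hc.flip hc'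
  have hstep : ∀ v i, d (T.vertexDart v (i + 1)) = !d (T.vertexDart v i) := by
    rintro (v | _ | j) i
    · exact hdr (.inr (v, i))
    · have h2 := hdr (.inl (.inr (none, i + 1)))
      have h3 : T.rot (.inl (.inr (none, i + 1))) = .inl (.inr (none, i)) := by
        change (Sum.inl (Sum.inr (none, i + 1 - 1)) : T.Dart) = _
        rw [add_sub_cancel_right]
      rw [h3] at h2
      change d (.inl (.inr (none, i + 1))) = !d (.inl (.inr (none, i)))
      rw [h2, Bool.not_not]
    · exact hdr (.inl (.inr (some j, i)))
  refine ⟨d, ⟨T.edge_invol, hde⟩, fun x => hdr (.inl (.inl x)), fun v i => ?_⟩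
  have h1 : d (T.vertexDart v 1) = !d (T.vertexDart v 0) := hstep v 0
  have h2 : d (T.vertexDart v 2) = !d (T.vertexDart v 1) := hstep v 1
  have h3 : d (T.vertexDart v 3) = !d (T.vertexDart v 2) := hstep v 2
  fin_cases i <;> simp [parity, h1, h2, h3]

theorem IsColouring.not {c : T.Dart → Bool} (h : T.IsColouring c) :
    T.IsColouring fun x => !c x :=
  ⟨⟨h.edge.invol, fun x => by rw [h.edge.flip]⟩, fun x => by rw [h.bend],
    fun v i => by rw [h.vertex, Bool.not_xor]⟩

theorem IsColouring.smoothing {c : T.Dart → Bool} (h : T.IsColouring c) (f : T.Vertex → Bool) :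
    Alternating c (T.smoothing f) := by
  have hp := fun v => isPlanarMatching_ite (f v = true)
  refine ⟨T.dart_cases (fun x => ?_) fun v i => ?_, T.dart_cases (fun x => ?_) fun v i => ?_⟩
  · rw [smoothing_bend, smoothing_bend, T.bend_invol]
  · rw [smoothing_vertex, smoothing_vertex, (hp v).invol]
  · rw [smoothing_bend, h.bend]
  · rw [smoothing_vertex, h.vertex, (hp v).parity, h.vertex v i, Bool.xor_not]

variable [DecidableEq T.Dart]

/-- Exchanging the points `0` and `2` turns `pair01` into `pair12`. As these points have the same
colour, the surgery lemmas apply to a change of smoothing. -/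
theorem smoothing_update (f : T.Vertex → Bool) [DecidableEq T.Vertex] (v : T.Vertex) :
    T.smoothing (Function.update f v (!f v)) =
      swap (T.vertexDart v 0) (T.vertexDart v 2) * T.smoothing f *
        swap (T.vertexDart v 0) (T.vertexDart v 2) := by
  have hi : Function.Injective (T.vertexDart v) := fun i j h => (T.vertexDart_injective h).2
  refine Equiv.ext (T.dart_cases (fun x => ?_) fun w i => ?_)
  · have h : ∀ x i, (.inl (.inl x) : T.Dart) ≠ T.vertexDart v i := by
      intro x i
      rcases v with v | v <;> simp [vertexDart]
    simp [smoothing_bend, swap_apply_of_ne_of_ne, h]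
  · by_cases hw : w = v
    · subst hw
      have hs := T.smoothing_vertex f w
      rw [smoothing_vertex, Function.update_self]
      cases hf : f w <;> rw [hf] at hs <;> fin_cases i <;>
        simp [hs, swap_apply_def, hi.eq_iff, pair01, pair12]
    · have h : ∀ i j, T.vertexDart w i ≠ T.vertexDart v j := fun i j h =>
        hw (T.vertexDart_injective h).1
      simp [smoothing_vertex, swap_apply_of_ne_of_ne, h, hw]

end TangleCode

/-! ### Composites as gluings of their pieces -/

namespace TangleCode

section fill

variable {n : ℕ} {k : Fin n → ℕ} (T : TangleCode n) (S : ∀ j, TangleCode (k j))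

/-- The edge ends of `T` and of the `S j`. -/
abbrev Pieces : Type := T.Dart ⊕ Σ j, (S j).Dart

/-- The piece an edge end belongs to. -/
def owner : Pieces T S → Option (Fin n) := Sum.elim (fun _ => none) fun x => some x.1

/-- The point `i` on the `j`-th hole of `T`. -/
def holeDart (j : Fin n) (i : Fin 4) : Pieces T S := .inl (T.vertexDart (.inr (some j)) i)

/-- The point `i` on the outer circle of `S j`. -/
def outerDart (j : Fin n) (i : Fin 4) : Pieces T S := .inr ⟨j, (S j).vertexDart (.inr none) i⟩

theorem holeDart_inj (j j' : Fin n) (i i' : Fin 4) (h : holeDart T S j i = holeDart T S j' i') :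
    j = j' ∧ i = i' := by
  have := T.vertexDart_injective (Sum.inl.inj h)
  simpa using this

theorem outerDart_injective (j : Fin n) : Function.Injective (outerDart T S j) := fun _ _ h =>
  ((S j).vertexDart_injective (eq_of_heq (Sigma.mk.inj (Sum.inr.inj h)).2)).2

/-- A permutation of the edge ends of each piece. -/
abbrev onPieces (p : Perm T.Dart) (q : ∀ j, Perm (S j).Dart) : Perm (Pieces T S) :=
  Equiv.sumCongr p (Equiv.sigmaCongrRight q)

theorem owner_onPieces (p : Perm T.Dart) (q : ∀ j, Perm (S j).Dart) (x : Pieces T S) :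
    owner T S (onPieces T S p q x) = owner T S x := by
  rcases x with x | ⟨j, x⟩ <;> rfl

theorem fillEquiv_edge (x : FillDart T S) :
    fillEquiv T S ((T.fill S).edge x) =
      onPieces T S T.edge (fun j => (S j).edge) (fillEquiv T S x) :=
  (fillEquiv T S).apply_symm_apply _

/-- A permutation of the edge ends of the composite that passes between `T` and the `S j` at the
places of gluing, and is given by `p` and `q` elsewhere, corresponds to the glued permutation. -/
theorem fillEquiv_apply_of_glue {ρ : Perm (FillDart T S)} {s' : Perm (Pieces T S)}
    {p : Perm T.Dart} {q : ∀ j, Perm (S j).Dart}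
    (h1 : ∀ j i, s' (holeDart T S j i) = outerDart T S j i ∧
      s' (outerDart T S j i) = holeDart T S j i)
    (h2 : ∀ x, (∀ j i, x ≠ holeDart T S j i ∧ x ≠ outerDart T S j i) →
      s' x = onPieces T S p q x)
    (hbend : ∀ x b, ρ (.inl (.inl (.inr (x, b)))) = .inl (.inl (.inr (x, !b))))
    (hTb : ∀ x, fillEquiv T S (ρ (.inl (.inl (.inl (.inl x))))) = .inl (p (.inl (.inl x))))
    (hSb : ∀ j x, fillEquiv T S (ρ (.inl (.inl (.inl (.inr ⟨j, x⟩))))) =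
      .inr ⟨j, q j (.inl (.inl x))⟩)
    (hTo : ∀ i, fillEquiv T S (ρ (.inl (.inr (none, i)))) = .inl (p (.inl (.inr (none, i)))))
    (hSo : ∀ j l i, fillEquiv T S (ρ (.inl (.inr (some (finSigmaFinEquiv ⟨j, l⟩), i)))) =
      .inr ⟨j, q j (.inl (.inr (some l, i)))⟩)
    (hTc : ∀ c i, fillEquiv T S (ρ (.inr (.inl c, i))) = .inl (p (.inr (c, i))))
    (hSc : ∀ j c i, fillEquiv T S (ρ (.inr (.inr ⟨j, c⟩, i))) = .inr ⟨j, q j (.inr (c, i))⟩)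
    (x : FillDart T S) : fillEquiv T S (ρ x) = s' (fillEquiv T S x) := by
  have hT : ∀ x : T.Dart, (∀ j i, x ≠ T.vertexDart (.inr (some j)) i) →
      s' (.inl x) = .inl (p x) := fun x hx =>
    h2 _ fun j i => ⟨fun h => hx j i (Sum.inl.inj h), Sum.inl_ne_inr⟩
  have hS : ∀ j (x : (S j).Dart), (∀ i, x ≠ (S j).vertexDart (.inr none) i) →
      s' (.inr ⟨j, x⟩) = .inr ⟨j, q j x⟩ := fun j x hx =>
    h2 _ fun j' i => ⟨Sum.inr_ne_inl, fun h => by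
      obtain ⟨rfl, h'⟩ := Sigma.mk.inj (Sum.inr.inj h)
      exact hx i (eq_of_heq h')⟩
  rcases x with ((((x | ⟨j, x⟩) | ⟨⟨j, i⟩, _ | _⟩) | ⟨_ | h, i⟩) | ⟨c | ⟨j, c⟩, i⟩)
  · exact (hTb x).trans (hT _ fun j i => by simp [vertexDart]).symm
  · exact (hSb j x).trans (hS _ _ fun i => by simp [vertexDart]).symm
  · rw [hbend]
    exact (h1 j i).1.symm
  · rw [hbend]
    exact (h1 j i).2.symm
  · exact (hTo i).trans (hT _ fun j i => by simp [vertexDart]).symm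
  · obtain ⟨⟨j, l⟩, rfl⟩ := finSigmaFinEquiv.surjective h
    have hx : fillEquiv T S (.inl (.inr (some (finSigmaFinEquiv ⟨j, l⟩), i))) =
        .inr ⟨j, .inl (.inr (some l, i))⟩ :=
      (fillEquiv T S).apply_symm_apply (.inr ⟨j, .inl (.inr (some l, i))⟩)
    rw [hx]
    exact (hSo j l i).trans (hS _ _ fun i => by simp [vertexDart]).symm
  · exact (hTc c i).trans (hT _ fun j i => by simp [vertexDart]).symm
  · exact (hSc j c i).trans (hS _ _ fun i => by simp [vertexDart]).symm

theorem fillEquiv_hole (j : Fin n) (l : Fin (k j)) (i : Fin 4) :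
    fillEquiv T S (.inl (.inr (some (finSigmaFinEquiv ⟨j, l⟩), i))) =
      .inr ⟨j, .inl (.inr (some l, i))⟩ :=
  (fillEquiv T S).apply_symm_apply (.inr ⟨j, .inl (.inr (some l, i))⟩)

/-- The composite map arises from the disjoint union of plane maps by gluing vertices, so its defect
is at most `0`; the genus inequality gives the other bound. -/
theorem isPlanar_fill (hT : T.IsPlanar) (hS : ∀ j, (S j).IsPlanar) : (T.fill S).IsPlanar := by
  classical
  obtain ⟨s', hd, h1, h2⟩ := exists_glue_maps (owner T S) (t := holeDart T S)
    (u := outerDart T S) (e := onPieces T S T.edge fun j => (S j).edge)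
    (s := onPieces T S T.rot fun j => (S j).rot) (holeDart_inj T S) (outerDart_injective T S)
    (fun _ _ => rfl) (fun _ _ => rfl) (owner_onPieces T S _ _) (owner_onPieces T S _ _)
    (fun _ _ => rfl) (fun _ _ => rfl) Finset.univ
  have h0 : defect (onPieces T S T.edge fun j => (S j).edge)
      (onPieces T S T.rot fun j => (S j).rot) = 0 := by
    rw [defect_sum, defect_sigma, T.isPlanar_iff.1 hT]
    simp [fun j => (S j).isPlanar_iff.1 (hS j)]
  rw [isPlanar_iff]
  refine le_antisymm ?_ (defect_nonneg _ _)
  refine le_trans (le_of_eq ?_) (hd.trans h0.le)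
  exact defect_equiv (X := (T.fill S).Dart) (fillEquiv T S) (fillEquiv_edge T S)
    (fillEquiv_apply_of_glue T S (fun j i => h1 j (Finset.mem_univ j) i)
      (fun x hx => h2 x fun j _ => hx j) (fun _ _ => rfl) (fun _ => rfl) (fun _ _ => rfl)
      (fun _ => rfl) (fun j l i => fillEquiv_hole T S j l (i + 1)) (fun _ _ => rfl)
      (fun _ _ _ => rfl))

/-- The closures differ by the smoothing at the outer circle, so their numbers of circles differ by
one. The larger number belongs to the closure `a'` whose two outer arcs lie on different circles. -/
theorem exists_complement {S : TangleCode n} {c : S.Dart → Bool} (hc : S.IsColouring c)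
    (β : Fin n → Fin 2) (σ : S.Crossing → Bool) :
    ∃ a a' : Fin 2, a' ≠ a ∧
      numOrbits S.edge (S.smoothing (S.choice a' β σ)) =
        numOrbits S.edge (S.smoothing (S.choice a β σ)) + 1 ∧
      ¬ Linked S.edge (S.smoothing (S.choice a' β σ))
        (S.vertexDart (.inr none) 0) (S.vertexDart (.inr none) 2) := by
  classical
  have hu : ∀ a a' : Fin 2, a' ≠ a → S.choice a' β σ =
      Function.update (S.choice a β σ) (.inr none) (!S.choice a β σ (.inr none)) := by
    intro a a' h
    funext v
    rcases v with v | _ | j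
    · simp [choice]
    · fin_cases a <;> fin_cases a' <;> simp [choice] at h ⊢
    · simp [choice]
  have hs := fun a a' h => (hu a a' h ▸ smoothing_update (S.choice a β σ) (.inr none) :
    S.smoothing (S.choice a' β σ) = _)
  have hcol : c (S.vertexDart (.inr none) 0) = c (S.vertexDart (.inr none) 2) := by
    rw [hc.vertex _ 2]
    simp [parity]
  have hne : S.vertexDart (.inr none) 0 ≠ S.vertexDart (.inr none) 2 := fun h => by
    simpa using (S.vertexDart_injective h).2
  by_cases h : Linked S.edge (S.smoothing (S.choice 0 β σ))
    (S.vertexDart (.inr none) 0) (S.vertexDart (.inr none) 2)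
  · refine ⟨0, 1, by decide, ?_⟩
    rw [hs 0 1 (by decide)]
    exact ⟨numOrbits_conj_swap_of_linked hc.edge (hc.smoothing _) hcol hne h,
      not_linked_conj_swap hc.edge (hc.smoothing _) hcol hne h⟩
  · refine ⟨1, 0, by decide, ?_, h⟩
    rw [hs 0 1 (by decide)]
    exact (numOrbits_conj_swap_of_not_linked hc.edge (hc.smoothing _) hcol h).symm

theorem linked_of_linked_onPieces {e p : Perm T.Dart} {f q : ∀ j, Perm (S j).Dart} {j : Fin n}
    {x y : (S j).Dart} (h : Linked (onPieces T S e f) (onPieces T S p q) (.inr ⟨j, x⟩)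
      (.inr ⟨j, y⟩)) :
    Linked (f j) (q j) x y := by
  let g : Pieces T S → Option (Σ j, Quot (Step (f j) (q j))) :=
    Sum.elim (fun _ => none) fun x => some ⟨x.1, Quot.mk _ x.2⟩
  have := h.map_eq (f := g)
    (by
      rintro (x | ⟨j, x⟩)
      · rfl
      · exact congrArg (fun z => some (Sigma.mk j z)) (Quot.sound (.inl rfl)).symm)
    (by
      rintro (x | ⟨j, x⟩)
      · rfl
      · exact congrArg (fun z => some (Sigma.mk j z)) (Quot.sound (.inr rfl)).symm)
  exact Quot.eqvGen_exact (eq_of_heq (Sigma.mk.inj (Option.some.inj this)).2)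

variable {T S}

/-- The number of circles of a state of the composite, when each `S j` is closed by the arcs that
are not the ones by which the `j`-th hole of `T` is filled. -/
theorem numOrbits_fill {c : T.Dart → Bool} (hc : T.IsColouring c)
    {d : ∀ j, (S j).Dart → Bool} (hd : ∀ j, (S j).IsColouring (d j)) (r : Fin 2)
    (β : Fin (∑ j, k j) → Fin 2) (σ : (T.fill S).Crossing → Bool) {a a' : Fin n → Fin 2}
    (ha : ∀ j, a' j ≠ a j)
    (hl : ∀ j, ¬ Linked (S j).edge
      ((S j).smoothing ((S j).choice (a' j) (fun l => β (finSigmaFinEquiv ⟨j, l⟩))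
        fun x => σ (.inr ⟨j, x⟩)))
      ((S j).vertexDart (.inr none) 0) ((S j).vertexDart (.inr none) 2)) :
    numOrbits (T.fill S).edge ((T.fill S).smoothing ((T.fill S).choice r β σ)) + 2 * n =
      numOrbits T.edge (T.smoothing (T.choice r a fun x => σ (.inl x))) +
        ∑ j, numOrbits (S j).edge
          ((S j).smoothing ((S j).choice (a' j) (fun l => β (finSigmaFinEquiv ⟨j, l⟩))
            fun x => σ (.inr ⟨j, x⟩))) := by
  classical
  -- Negating the colouring of some `S j` makes colours opposite at identified points, as the new
  -- connections require.
  wlog hcd : ∀ j, d j ((S j).vertexDart (.inr none) 0) = !c (T.vertexDart (.inr (some j)) 0)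
    generalizing d
  · refine this (d := fun j x => if d j ((S j).vertexDart (.inr none) 0) =
      !c (T.vertexDart (.inr (some j)) 0) then d j x else !d j x) (fun j => ?_) fun j => ?_
    · split_ifs
      · exact hd j
      · exact (hd j).not
    · split_ifs with h
      · exact h
      · simpa using h
  obtain ⟨s', -, hn, -, h1, h2⟩ := exists_glue_matchings (owner T S) (t := holeDart T S)
    (u := outerDart T S) (e := onPieces T S T.edge fun j => (S j).edge)
    (s := onPieces T S (T.smoothing (T.choice r a fun x => σ (.inl x))) fun j =>
      (S j).smoothing ((S j).choice (a' j) (fun l => β (finSigmaFinEquiv ⟨j, l⟩))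
        fun x => σ (.inr ⟨j, x⟩)))
    (c := Sum.elim c fun x => d x.1 x.2)
    ⟨by rintro (x | ⟨j, x⟩) <;> simp [edge_invol],
      by rintro (x | ⟨j, x⟩) <;> simp [hc.edge.flip, (hd _).edge.flip]⟩
    ⟨by rintro (x | ⟨j, x⟩) <;> simp [(hc.smoothing _).invol, ((hd _).smoothing _).invol],
      by rintro (x | ⟨j, x⟩) <;> simp [(hc.smoothing _).flip, ((hd _).smoothing _).flip]⟩
    (holeDart_inj T S) (outerDart_injective T S)
    (fun _ _ => rfl) (fun _ _ => rfl) (owner_onPieces T S _ _) (owner_onPieces T S _ _)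
    (fun j i => by
      change d j _ = !c _
      rw [(hd j).vertex, hc.vertex, hcd, Bool.not_xor])
    (p := fun j => if a j = 1 then pair01 else pair12) (fun j => isPlanarMatching_ite _)
    (fun j i => by
      refine congrArg Sum.inl ((T.smoothing_vertex _ _ i).trans ?_)
      simp [choice])
    (fun j i => by
      refine congrArg (fun z => (Sum.inr ⟨j, z⟩ : Pieces T S))
        (((S j).smoothing_vertex _ (.inr none) i :
          (S j).smoothing ((S j).choice (a' j) _ _) _ = _).trans ?_)
      -- The closure `a' j` of `S j` and the fundamental tangle `a j` in the hole pair the four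
      -- points in the same way.
      have : a' j = 0 ↔ a j = 1 := by
        have := ha j
        generalize a j = x at *
        generalize a' j = y at *
        fin_cases x <;> fin_cases y <;> simp_all
      simp [choice, this])
    (fun j h => hl j (linked_of_linked_onPieces T S h)) Finset.univ
  rw [numOrbits_sum, numOrbits_sigma, Finset.card_univ, Fintype.card_fin] at hn
  rw [← hn]
  congr 1
  refine numOrbits_equiv (fillEquiv T S) (fillEquiv_edge T S)
    (fillEquiv_apply_of_glue T S (fun j i => h1 j (Finset.mem_univ j) i)
      (fun x hx => h2 x fun j _ => hx j) (fun _ _ => rfl) (fun _ => rfl) (fun _ _ => rfl)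
      (fun _ => rfl) (fun j l i => ?_) (fun _ _ => rfl) (fun _ _ _ => rfl))
  exact fillEquiv_hole T S j l _

end fill

end TangleCode

/-! ### The bracket at the eighth root of unity -/

theorem root8_sq : root8 ^ 2 = Complex.I := by
  rw [root8, ← Complex.exp_nat_mul,
    show ((2 : ℕ) : ℂ) * (Real.pi / 4 * Complex.I) = Real.pi / 2 * Complex.I by push_cast; ring,
    Complex.exp_pi_div_two_mul_I]

theorem root8_ne_zero : root8 ≠ 0 := Complex.exp_ne_zero _

theorem root8_loop : -root8 ^ 2 - root8⁻¹ ^ 2 = 0 := by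
  rw [inv_pow, root8_sq, Complex.inv_I]
  ring

theorem zero_zpow_sub_one (m : ℕ) : (0 : ℂ) ^ ((m : ℤ) - 1) = if m = 1 then 1 else 0 := by
  split_ifs with h
  · simp [h]
  -- The case `m = 0` is included, since the inverse of `0` is `0`.
  · exact zero_zpow _ (by omega)

/-- The factor of a splitting in the state sum. -/
def splitWeight (b : Bool) : ℂ := if b = true then root8 else root8⁻¹

theorem prod_splitWeight_eq_card {C : Type} [Fintype C] (σ : C → Bool) :
    root8 ^ (Finset.univ.filter fun c => σ c = true).card *
      root8⁻¹ ^ (Finset.univ.filter fun c => σ c = false).card = ∏ c, splitWeight (σ c) := by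
  simp only [splitWeight]
  rw [Finset.prod_ite, Finset.prod_const, Finset.prod_const]
  simp only [Bool.not_eq_true]

namespace TangleCode

variable {n : ℕ} (T : TangleCode n)

/-- The number of circles of a state of a closure. -/
def loops (r : Fin 2) (α : Fin n → Fin 2) (σ : T.Crossing → Bool) : ℕ :=
  numOrbits T.edge (T.smoothing (T.choice r α σ))

theorem loops_pos (r : Fin 2) (α : Fin n → Fin 2) (σ : T.Crossing → Bool) : 0 < T.loops r α σ :=
  T.numOrbits_pos _

theorem bracket_closure (r : Fin 2) (α : Fin n → Fin 2) :
    (T.closure r α).bracket root8 =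
      ∑ σ : T.Crossing → Bool, (∏ c, splitWeight (σ c)) * if T.loops r α σ = 1 then 1 else 0 := by
  unfold LinkCode.bracket
  refine Finset.sum_congr rfl fun σ _ => ?_
  rw [root8_loop, zero_zpow_sub_one,
    show (T.closure r α).circles σ = T.loops r α σ from T.circles_closure r α σ]
  exact congrArg (· * _) (prod_splitWeight_eq_card (C := T.Crossing) σ)

/-! ### The bracket of a composite -/

section fill

variable {k : Fin n → ℕ} {T} {S : ∀ j, TangleCode (k j)}

theorem add_sum_eq_iff {a : ℕ} {g : Fin n → ℕ} (ha : 0 < a) (hg : ∀ j, 0 < g j) :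
    a + ∑ j, g j = 1 + n ↔ a = 1 ∧ ∀ j, g j = 1 := by
  have hle := Finset.sum_le_sum fun j (_ : j ∈ Finset.univ) => Nat.succ_le_of_lt (hg j)
  have heq := Finset.sum_eq_sum_iff_of_le fun j (_ : j ∈ Finset.univ) => Nat.succ_le_of_lt (hg j)
  simp only [Finset.sum_const, Finset.card_univ, Fintype.card_fin, smul_eq_mul, mul_one,
    Nat.succ_eq_add_one, zero_add, Finset.mem_univ, true_imp_iff] at hle heq
  constructor
  · intro h
    exact ⟨by omega, fun j => (heq.1 (by omega) j).symm⟩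
  · rintro ⟨h1, h2⟩
    have := heq.2 fun j => (h2 j).symm
    omega

/-- Only the tuple `a` of closures with fewer circles can contribute. For it, the circle count of
the composite plus `n` is the sum of `n + 1` positive circle counts. -/
theorem loops_fill_eq_one (hT : T.IsPlanar) (hS : ∀ j, (S j).IsPlanar) (r : Fin 2)
    (β : Fin (∑ j, k j) → Fin 2) (σ : (T.fill S).Crossing → Bool) :
    (if (T.fill S).loops r β σ = 1 then (1 : ℂ) else 0) =
      ∑ a : Fin n → Fin 2, (if T.loops r a (fun x => σ (.inl x)) = 1 then 1 else 0) *
        ∏ j, if (S j).loops (a j) (fun l => β (finSigmaFinEquiv ⟨j, l⟩))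
          (fun x => σ (.inr ⟨j, x⟩)) = 1 then 1 else 0 := by
  obtain ⟨c, hc⟩ := exists_isColouring hT
  choose d hd using fun j => exists_isColouring (hS j)
  choose a a' ha hn hl using fun j => exists_complement (hd j)
    (fun l => β (finSigmaFinEquiv ⟨j, l⟩)) fun x => σ (.inr ⟨j, x⟩)
  have key := numOrbits_fill hc hd r β σ ha hl
  simp only [hn] at key
  rw [Finset.sum_eq_single a]
  · rw [Finset.prod_boole, boole_mul]
    suffices hiff : (T.fill S).loops r β σ = 1 ↔ T.loops r a (fun x => σ (.inl x)) = 1 ∧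
        ∀ j ∈ Finset.univ, (S j).loops (a j) (fun l => β (finSigmaFinEquiv ⟨j, l⟩))
          (fun x => σ (.inr ⟨j, x⟩)) = 1 by
      rw [if_congr hiff rfl rfl]
      split_ifs <;> tauto
    rw [Finset.sum_add_distrib] at key
    simp only [Finset.sum_const, Finset.card_univ, Fintype.card_fin, smul_eq_mul, mul_one] at key
    have := add_sum_eq_iff (T.loops_pos r a fun x => σ (.inl x)) fun j => (S j).loops_pos (a j)
      (fun l => β (finSigmaFinEquiv ⟨j, l⟩)) fun x => σ (.inr ⟨j, x⟩)
    simp only [Finset.mem_univ, true_imp_iff]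
    rw [← this]
    unfold loops
    omega
  · intro b _ hb
    obtain ⟨j, hbj⟩ := Function.ne_iff.1 hb
    have hba : b j = a' j := by
      have := ha j
      generalize a j = x at *
      generalize a' j = y at *
      generalize b j = z at *
      revert x y z
      decide
    refine mul_eq_zero_of_right _ (Finset.prod_eq_zero (Finset.mem_univ j) (if_neg ?_))
    have := (S j).loops_pos (a j) (fun l => β (finSigmaFinEquiv ⟨j, l⟩))
      fun x => σ (.inr ⟨j, x⟩)
    unfold loops at this ⊢
    rw [hba, hn]
    omega
  · simp

/-- A state of the composite consists of a state of `T` and states of the `S j`. -/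
def stateEquiv (T : TangleCode n) (S : ∀ j, TangleCode (k j)) :
    ((T.Crossing → Bool) × ∀ j, (S j).Crossing → Bool) ≃ ((T.fill S).Crossing → Bool) where
  toFun σ := Sum.elim σ.1 fun x => σ.2 x.1 x.2
  invFun σ := (fun x => σ (.inl x), fun j x => σ (.inr ⟨j, x⟩))
  left_inv _ := rfl
  right_inv σ := by
    funext x
    rcases x with x | ⟨j, x⟩ <;> rfl

theorem sum_mul_prod_sum {A : Type} [Fintype A] {ι : Type} [Fintype ι] [DecidableEq ι]
    {B : ι → Type} [∀ j, Fintype (B j)] (f : A → ℂ) (g : ∀ j, B j → ℂ) :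
    (∑ a, f a) * ∏ j, ∑ b, g j b = ∑ p : A × ∀ j, B j, f p.1 * ∏ j, g j (p.2 j) := by
  rw [Finset.prod_univ_sum, Fintype.piFinset_univ, Finset.sum_mul_sum, Fintype.sum_prod_type]

theorem bracket_fill (hT : T.IsPlanar) (hS : ∀ j, (S j).IsPlanar) (r : Fin 2)
    (β : Fin (∑ j, k j) → Fin 2) :
    ((T.fill S).closure r β).bracket root8 =
      ∑ a : Fin n → Fin 2, (T.closure r a).bracket root8 *
        ∏ j, ((S j).closure (a j) fun l => β (finSigmaFinEquiv ⟨j, l⟩)).bracket root8 := by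
  simp only [bracket_closure, sum_mul_prod_sum]
  rw [Finset.sum_comm, ← Equiv.sum_comp (stateEquiv T S)]
  refine Finset.sum_congr rfl fun p _ => ?_
  rw [loops_fill_eq_one hT hS, Finset.mul_sum]
  refine Finset.sum_congr rfl fun a _ => ?_
  have : ∏ c, splitWeight (stateEquiv T S p c) =
      (∏ c, splitWeight (p.1 c)) * ∏ j, ∏ c, splitWeight (p.2 j c) :=
    (Fintype.prod_sum_type _).trans (congrArg _ (Fintype.prod_sigma _))
  rw [this, Finset.prod_mul_distrib, mul_mul_mul_comm]
  rfl

end fill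

/-! ### Integrality -/

/-- Every `v` is reached from the constant `false` by flips, each of which changes the parity of
`f`. -/
theorem parity_of_flip {ι : Type} [Fintype ι] [DecidableEq ι] {f : (ι → Bool) → ℕ}
    (hf : ∀ v i, (f (Function.update v i (!v i)) + f v) % 2 = 1) (v : ι → Bool) :
    (f v + ∑ i, if v i = true then 1 else 0) % 2 = f (fun _ => false) % 2 := by
  have key : ∀ s : Finset ι, (f (fun i => decide (i ∈ s)) + s.card) % 2 =
      f (fun _ => false) % 2 := by
    intro s
    induction s using Finset.induction_on with
    | empty => simp
    | insert i s hi ih =>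
      have h := hf (fun i => decide (i ∈ s)) i
      have : Function.update (fun i => decide (i ∈ s)) i (!decide (i ∈ s)) =
          fun j => decide (j ∈ insert i s) := by
        funext j
        by_cases hj : j = i
        · subst hj; simp [hi]
        · simp [hj]
      rw [this] at h
      rw [Finset.card_insert_of_notMem hi]
      omega
  have := key (Finset.univ.filter fun i => v i = true)
  rw [Finset.card_filter] at this
  simpa using this

theorem exists_parity (hT : T.IsPlanar) : ∃ κ : ℕ, ∀ r α σ, T.loops r α σ = 1 →
    Even (countTwo α + r + κ + ∑ c, if σ c = true then 1 else 0) := by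
  classical
  obtain ⟨c, hc⟩ := exists_isColouring hT
  have hflip : ∀ v i, (numOrbits T.edge (T.smoothing (Function.update v i (!v i))) +
      numOrbits T.edge (T.smoothing v)) % 2 = 1 := by
    intro v i
    rw [smoothing_update]
    have hcol : c (T.vertexDart i 0) = c (T.vertexDart i 2) := by
      rw [hc.vertex _ 2]
      simp [parity]
    have hne : T.vertexDart i 0 ≠ T.vertexDart i 2 := fun h => by
      simpa using (T.vertexDart_injective h).2
    by_cases h : Linked T.edge (T.smoothing v) (T.vertexDart i 0) (T.vertexDart i 2)
    · have := numOrbits_conj_swap_of_linked hc.edge (hc.smoothing v) hcol hne h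
      omega
    · have := numOrbits_conj_swap_of_not_linked hc.edge (hc.smoothing v) hcol h
      omega
  -- The constant `κ` is the number of circles when every vertex, boundary circles included, is
  -- smoothed by `pair12`.
  refine ⟨numOrbits T.edge (T.smoothing fun _ => false), fun r α σ h => ?_⟩
  have h1 := parity_of_flip (f := fun v => numOrbits T.edge (T.smoothing v)) hflip
    (T.choice r α σ)
  simp only [Fintype.sum_sum_type, Fintype.sum_option] at h1
  simp only [choice, Sum.elim_inl, Sum.elim_inr, Option.elim_none, Option.elim_some,
    decide_eq_true_eq] at h1
  rw [← Finset.card_filter (fun j => α j = 1)] at h1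
  change (T.loops r α σ + _) % 2 = _ at h1
  rw [h] at h1
  have h2 : (1 + ((∑ c, if σ c = true then 1 else 0) + ((if r = 0 then 1 else 0) +
      countTwo α))) % 2 = numOrbits T.edge (T.smoothing fun _ => false) % 2 := by
    rw [countTwo]
    convert h1
    split_ifs <;> simp_all
  rw [Nat.even_iff]
  have hr : (if r = 0 then 1 else 0) + (r : ℕ) = 1 := by
    fin_cases r <;> rfl
  omega

theorem prod_splitWeight {C : Type} [Fintype C] (σ : C → Bool) :
    ∏ c, splitWeight (σ c) =
      (root8 ^ Fintype.card C)⁻¹ * Complex.I ^ ∑ c, if σ c = true then 1 else 0 := by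
  have : ∀ b, splitWeight b = root8⁻¹ * Complex.I ^ (if b = true then 1 else 0) := by
    intro b
    cases b
    · simp [splitWeight]
    · simp [splitWeight, ← root8_sq, sq, root8_ne_zero]
  simp only [this, Finset.prod_mul_distrib, Finset.prod_const, Finset.prod_pow_eq_pow_sum,
    Finset.card_univ, inv_pow]

theorem exists_int_of_even {t m : ℕ} (h : Even (t + m)) :
    ∃ q : ℤ, (-Complex.I) ^ t * Complex.I ^ m = q := by
  obtain ⟨p, hp⟩ := h
  refine ⟨(-1) ^ t * (-1) ^ p, ?_⟩
  rw [neg_pow, mul_assoc, ← pow_add, hp, ← two_mul, pow_mul, Complex.I_sq]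
  push_cast
  rfl

theorem exists_mem_invariant (hT : T.IsPlanar) : ∃ M, M ∈ T.invariant := by
  obtain ⟨κ, hκ⟩ := T.exists_parity hT
  -- The power of `root8` cancels the common factor in `prod_splitWeight`, and `I ^ κ` makes the
  -- total exponent even on single-circle states.
  let z : ℂ := root8 ^ Fintype.card T.Crossing * Complex.I ^ κ
  have hz : z ^ 8 = 1 := by
    have h8 : root8 ^ 8 = 1 := by
      rw [show 8 = 2 * 4 from rfl, pow_mul, root8_sq, Complex.I_pow_four]
    have hI : Complex.I ^ 8 = 1 := by
      rw [show 8 = 4 * 2 from rfl, pow_mul, Complex.I_pow_four, one_pow]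
    rw [mul_pow, pow_right_comm, h8, pow_right_comm, hI, one_pow, one_pow, one_mul]
  have key : ∀ (r : Fin 2) (α : Fin n → Fin 2), ∃ q : ℤ, (q : ℂ) =
      (-Complex.I) ^ countTwo α * Complex.I ^ (r : ℕ) * z * (T.closure r α).bracket root8 := by
    intro r α
    rw [bracket_closure, Finset.mul_sum]
    have hterm : ∀ σ : T.Crossing → Bool, ∃ q : ℤ, (q : ℂ) =
        (-Complex.I) ^ countTwo α * Complex.I ^ (r : ℕ) * z *
          ((∏ c, splitWeight (σ c)) * if T.loops r α σ = 1 then 1 else 0) := by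
      intro σ
      split_ifs with h
      · have heven := hκ r α σ h
        rw [add_assoc, add_assoc] at heven
        obtain ⟨q, hq⟩ := exists_int_of_even heven
        refine ⟨q, ?_⟩
        rw [← hq, prod_splitWeight, pow_add, pow_add]
        have := pow_ne_zero (Fintype.card T.Crossing) root8_ne_zero
        simp only [z]
        field_simp
      · exact ⟨0, by simp⟩
    choose q hq using hterm
    exact ⟨∑ σ, q σ, by push_cast; exact Finset.sum_congr rfl fun σ _ => hq σ⟩
  choose q hq using key
  exact ⟨Matrix.of fun r i => q r (dictTwo n i), z, hz, fun r i => hq r _⟩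

/-- Comparing a nonzero entry of two members shows that the ratio of their factors `z` is real with
eighth power `1`, hence `±1`, and this sign is common to all entries. -/
theorem invariant_eq_projClass {M : Matrix (Fin 2) (Fin (2 ^ n)) ℤ} (hM : M ∈ T.invariant) :
    T.invariant = projClass M := by
  obtain ⟨z, hz, hM⟩ := hM
  have hz0 : z ≠ 0 := by
    rintro rfl
    norm_num at hz
  ext M'
  constructor
  · rintro ⟨z', hz', hM'⟩
    have hcross : ∀ r i, (M' r i : ℂ) * z = M r i * z' := fun r i => by
      rw [hM', hM]
      ring
    by_cases h0 : M = 0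
    · refine .inl (Matrix.ext fun r i => ?_)
      have := hcross r i
      rw [h0] at this ⊢
      simpa [hz0] using this
    · obtain ⟨r, i, hri⟩ : ∃ r i, M r i ≠ 0 := by
        by_contra! h
        exact h0 (Matrix.ext h)
      have h8 : (M' r i) ^ 8 = (M r i) ^ 8 := by
        have := congrArg (· ^ 8) (hcross r i)
        simp only [mul_pow, hz, hz', mul_one] at this
        exact_mod_cast this
      have hC : (M r i : ℂ) ≠ 0 := by exact_mod_cast hri
      rcases pow_eq_pow_iff_cases.1 h8 with h | h | ⟨h, -⟩
      · cases h
      · have hzz : z' = z := by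
          have := hcross r i
          rw [h] at this
          exact (mul_left_cancel₀ hC this).symm
        exact .inl (Matrix.ext fun r i => by
          have := hcross r i
          rw [hzz] at this
          exact_mod_cast mul_right_cancel₀ hz0 this)
      · have hzz : z' = -z := by
          have := hcross r i
          rw [h, Int.cast_neg, neg_mul, ← mul_neg] at this
          exact (mul_left_cancel₀ hC this).symm
        exact .inr (Matrix.ext fun r i => by
          have := hcross r i
          rw [hzz, mul_neg, ← neg_mul] at this
          exact_mod_cast mul_right_cancel₀ hz0 this)
  · rintro (rfl | rfl)
    · exact ⟨z, hz, hM⟩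
    · exact ⟨-z, by rw [Even.neg_pow (by decide), hz], fun r i => by
        rw [Matrix.neg_apply, Int.cast_neg, hM]
        ring⟩

end TangleCode

/-! ### Dictionary orders -/

section dictionary

variable {n : ℕ}

theorem sum_castLE_eq_sum_range (k : Fin n → ℕ) (j : Fin n) :
    ∑ i : Fin j, k (Fin.castLE j.2.le i) =
      ∑ i ∈ Finset.range j, if h : i < n then k ⟨i, h⟩ else 0 := by
  rw [← Fin.sum_univ_eq_sum_range (fun i => if h : i < n then k ⟨i, h⟩ else 0)]
  refine Finset.sum_congr rfl fun i _ => ?_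
  rw [dif_pos (i.2.trans j.2)]
  rfl

theorem finSigmaFinEquiv_lt_of_fst_lt {k : Fin n → ℕ} {x y : Σ j, Fin (k j)} (h : x.1 < y.1) :
    finSigmaFinEquiv x < finSigmaFinEquiv y := by
  rw [Fin.lt_def, finSigmaFinEquiv_apply, finSigmaFinEquiv_apply, sum_castLE_eq_sum_range,
    sum_castLE_eq_sum_range]
  have h1 := Finset.sum_le_sum_of_subset (f := fun i => if h : i < n then k ⟨i, h⟩ else 0)
    (Finset.range_mono (Nat.succ_le_of_lt h))
  rw [Nat.succ_eq_add_one, Finset.sum_range_succ, dif_pos x.1.2] at h1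
  have h2 := x.2.2
  simp only [Fin.eta] at h1
  omega

theorem finSigmaFinEquiv_le_of_snd_le {k : Fin n → ℕ} {j : Fin n} {l m : Fin (k j)} (h : l ≤ m) :
    finSigmaFinEquiv ⟨j, l⟩ ≤ finSigmaFinEquiv ⟨j, m⟩ := by
  rw [Fin.le_def, finSigmaFinEquiv_apply, finSigmaFinEquiv_apply]
  exact Nat.add_le_add_left h _

/-- The dictionary order on `{1, 2}^(k_1 + ⋯ + k_n)` is the dictionary order on the product of the
dictionary ordered sets `{1, 2}^(k_j)`. -/
theorem dictTwo_finSigmaFinEquiv (k : Fin n → ℕ) (l : Fin (2 ^ ∑ j, k j)) (j : Fin n)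
    (m : Fin (k j)) :
    dictTwo (∑ j, k j) l (finSigmaFinEquiv ⟨j, m⟩) = dictTwo (k j) (dictPow k l j) m := by
  let g : Fin (2 ^ ∑ j, k j) → Lex (Fin (∑ j, k j) → Fin 2) := fun l => toLex fun x =>
    dictTwo (k (finSigmaFinEquiv.symm x).1) (dictPow k l (finSigmaFinEquiv.symm x).1)
      (finSigmaFinEquiv.symm x).2
  -- Concatenating the blocks preserves order: the first differing position of the concatenations is
  -- the first differing place in the first differing block.
  have hg : StrictMono g := by
    intro a b hab
    obtain ⟨j, hj, hlt⟩ : dict (fun j => 2 ^ k j) _ (Finset.prod_pow_eq_pow_sum _ _ _) a <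
      dict (fun j => 2 ^ k j) _ (Finset.prod_pow_eq_pow_sum _ _ _) b := OrderIso.strictMono _ hab
    obtain ⟨m, hm, hlt'⟩ : dict (fun _ : Fin (k j) => 2) (2 ^ k j) (by simp) (dictPow k a j) <
      dict (fun _ : Fin (k j) => 2) (2 ^ k j) (by simp) (dictPow k b j) :=
        OrderIso.strictMono _ hlt
    refine ⟨finSigmaFinEquiv ⟨j, m⟩, fun x hx => ?_, ?_⟩
    · obtain ⟨⟨j', m'⟩, rfl⟩ := finSigmaFinEquiv.surjective x
      simp only [g]
      change dictTwo (k (finSigmaFinEquiv.symm _).1) _ _ =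
        dictTwo (k (finSigmaFinEquiv.symm _).1) _ _
      rw [Equiv.symm_apply_apply]
      rcases lt_trichotomy j' j with h | rfl | h
      · have : dictPow k a j' = dictPow k b j' := hj j' h
        simp only [this]
      · refine hm m' ?_
        by_contra hc
        exact absurd (finSigmaFinEquiv_le_of_snd_le (not_lt.1 hc)) (not_le.2 hx)
      · exact absurd (finSigmaFinEquiv_lt_of_fst_lt (x := ⟨j, m⟩) (y := ⟨j', m'⟩) h)
          (not_lt.2 hx.le)
    · change dictTwo (k (finSigmaFinEquiv.symm _).1) _ _ <
        dictTwo (k (finSigmaFinEquiv.symm _).1) _ _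
      rw [Equiv.symm_apply_apply]
      exact hlt'
  let f := dict (fun _ : Fin (∑ j, k j) => 2) (2 ^ ∑ j, k j) (by simp)
  have hcard : Fintype.card (Fin (2 ^ ∑ j, k j)) =
      Fintype.card (Lex (Fin (∑ j, k j) → Fin 2)) := Fintype.card_congr f.toEquiv
  -- Both are strictly increasing and onto, so they are the same enumeration.
  have hfg : ⇑f = g := (f.strictMono.range_inj hg).1 <| by
    rw [f.surjective.range_eq,
      ((Fintype.bijective_iff_injective_and_card g).2 ⟨hg.injective, hcard⟩).2.range_eq]
  have := congrFun (congrArg ofLex (congrFun hfg l)) (finSigmaFinEquiv ⟨j, m⟩)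
  refine this.trans ?_
  change dictTwo (k (finSigmaFinEquiv.symm _).1) _ _ = _
  rw [Equiv.symm_apply_apply]

/-- `dictTwo` as an equivalence. -/
def dictTwoEquiv (n : ℕ) : Fin (2 ^ n) ≃ (Fin n → Fin 2) :=
  (dict (fun _ : Fin n => 2) (2 ^ n) (by simp)).toEquiv.trans ofLex

theorem countTwo_sigma {k : Fin n → ℕ} (β : Fin (∑ j, k j) → Fin 2) :
    countTwo β = ∑ j, countTwo fun l => β (finSigmaFinEquiv ⟨j, l⟩) := by
  simp only [countTwo, Finset.card_filter]
  rw [← Equiv.sum_comp finSigmaFinEquiv, Fintype.sum_sigma]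

theorem sum_val_eq_countTwo (α : Fin n → Fin 2) : ∑ j, (α j : ℕ) = countTwo α := by
  rw [countTwo, Finset.card_filter]
  refine Finset.sum_congr rfl fun j _ => ?_
  generalize α j = a
  fin_cases a <;> rfl

end dictionary

/-! ### The matrix formula for the composite -/

namespace TangleCode

theorem mul_eta_mem_invariant_fill {n : ℕ} {k : Fin n → ℕ} {T : TangleCode n}
    {S : ∀ j, TangleCode (k j)} (hT : T.IsPlanar) (hS : ∀ j, (S j).IsPlanar)
    {A : Matrix (Fin 2) (Fin (2 ^ n)) ℤ} {b : ∀ j, Matrix (Fin 2) (Fin (2 ^ k j)) ℤ}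
    (hA : A ∈ T.invariant) (hb : ∀ j, b j ∈ (S j).invariant) :
    A * eta k b ∈ (T.fill S).invariant := by
  obtain ⟨z, hz, hA⟩ := hA
  choose w hw hb using hb
  -- The normalising factors of the pieces multiply to one for the composite.
  refine ⟨z * ∏ j, w j, ?_, fun r l => ?_⟩
  · rw [mul_pow, hz, ← Finset.prod_pow]
    simp [hw]
  · rw [bracket_fill hT hS, Finset.mul_sum, Matrix.mul_apply, Int.cast_sum,
      ← Equiv.sum_comp (dictTwoEquiv n)]
    refine Finset.sum_congr rfl fun i _ => ?_
    change _ = _ * ((T.closure r (dictTwo n i)).bracket root8 *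
      ∏ j, ((S j).closure (dictTwo n i j) _).bracket root8)
    simp only [Int.cast_mul, eta_apply, Int.cast_prod, hA, hb, Finset.prod_mul_distrib]
    simp only [dictTwo_finSigmaFinEquiv, countTwo_sigma (dictTwo (∑ j, k j) l)]
    rw [Finset.prod_pow_eq_pow_sum, Finset.prod_pow_eq_pow_sum, sum_val_eq_countTwo]
    -- The column factor of `T` cancels the row factors of the `S j`, since `dictTwo n i j` serves
    -- both as filling and as closure.
    have h : (-Complex.I) ^ countTwo (dictTwo n i) * Complex.I ^ countTwo (dictTwo n i) = 1 := by
      rw [← mul_pow, neg_mul, Complex.I_mul_I, neg_neg, one_pow]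
    linear_combination (Complex.I ^ (r : ℕ) * z * (T.closure r (dictTwo n i)).bracket root8 *
      (-Complex.I) ^ (∑ j, countTwo (dictTwo (k j) (dictPow k l j))) * (∏ j, w j) *
      ∏ j, ((S j).closure (dictTwo n i j) (dictTwo (k j) (dictPow k l j))).bracket root8) * h

end TangleCode

end PuncturedTangle

end

open PuncturedTangle
theorem theorem3p2 (n : ℕ) (hn : 0 < n) (k : Fin n → ℕ)
    (T : TangleDiagram n) (S : ∀ j : Fin n, TangleDiagram (k j)) :
    -- the composite is a punctured ball tangle diagram
    (T.toTangleCode.fill fun j => (S j).toTangleCode).IsPlanar ∧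
    -- the invariants are projective integer matrices
    (∃ A : Matrix (Fin 2) (Fin (2 ^ n)) ℤ, T.invariant = projClass A) ∧
    (∀ j, ∃ b : Matrix (Fin 2) (Fin (2 ^ k j)) ℤ, (S j).invariant = projClass b) ∧
    -- the formula, for all representatives of the projective matrices
    ∀ (A : Matrix (Fin 2) (Fin (2 ^ n)) ℤ) (b : ∀ j, Matrix (Fin 2) (Fin (2 ^ k j)) ℤ),
      T.invariant = projClass A → (∀ j, (S j).invariant = projClass (b j)) →
        (T.toTangleCode.fill fun j => (S j).toTangleCode).invariant =
          projClass (A * eta k b) := by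
  refine ⟨TangleCode.isPlanar_fill _ _ T.planar fun j => (S j).planar,
    (T.exists_mem_invariant T.planar).imp fun M hM => T.invariant_eq_projClass hM,
    fun j => ((S j).exists_mem_invariant (S j).planar).imp fun M hM =>
      (S j).invariant_eq_projClass hM, fun A b hA hb => ?_⟩
  refine TangleCode.invariant_eq_projClass _
    (TangleCode.mul_eta_mem_invariant_fill T.planar (fun j => (S j).planar) ?_ fun j => ?_)
  · exact hA ▸ Or.inl rfl
  · exact hb j ▸ Or.inl rfl
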